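/- **Setting.** Let $M\ge 1$ be an integer, $r,t\in[0,1]$ with $r^2+t^2=1$ and $rt\neq 0$; $\mathbb T\subset\mathbb C$ is the unit circle, $dl$ its normalized Lebesgue measure, and second indices are taken modulo $2M$. For phases $p\in\mathbb T^{\mathbb Z\times\mathbb Z_{2M}}$ let $U(p)=D(p)\mathbb S$ on $l^2(\mathbb Z\times\mathbb Z_{2M})$ (Chalker–Coddington model on the cylinder), where $D(p)$ is diagonal with entries $p_{n,k}$ and $$\mathbb S e_{2j,2k}=t\,e_{2j+1,2k}+r\,e_{2j,2k+1},\qquad \mathbb S e_{2j+1,2k+1}=-r\,e_{2j+1,2k}+t\,e_{2j,2k+1},$$ $$\mathbb S e_{2j+2,2k+1}=t\,e_{2j+2,2k+2}+r\,e_{2j+1,2k+1},\qquad \mathbb S e_{2j+1,2k+2}=-r\,e_{2j+2,2k+2}+t\,e_{2j+1,2k+1}.$$ The phases are i.i.d. with law $dl$. For $L\in\mathbb N$ let $U^D=U^D_L(p)$ be the unitary matrix on $l^2(\{-2L,\dots,2L\}\times\mathbb Z_{2M})$ with $$U^De_{-2L,2k+1}=e_{-2L,2k+2},\qquad U^De_{2L,2k}=e_{2L,2k+1},$$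 and all other columns equal to those of $U(p)$ (reflecting boundary conditions). Let $\mu_L^{(M)}=\mu_L^{(M)}(p)$ be the normalized counting measure of the eigenvalues of $U^D$ (with multiplicity). For $z\ne0$ let $M_1(z)$ be the $2M\times 2M$ matrix with diagonal blocks $\frac1t\begin{pmatrix}z^{-1}&-r\\-r&z\end{pmatrix}$ on the coordinates $(2k,2k+1)$, and $M_2(z)$ the one with blocks $\frac1r\begin{pmatrix}z&-t\\t&-z^{-1}\end{pmatrix}$ on the coordinates $(2k+1,2k+2)$, $k\in\mathbb Z_M$. Put $$A_z(j)=D_l(j)\,M_2(z)\,D_m(j)\,M_1(z)\,D_r(j),\qquad j\in\mathbb Z,$$ with diagonal matrices $D_l(j)=\mathrm{diag}(p_{2j+2,0},1,p_{2j+2,2},1,\dots)$, $D_m(j)=\mathrm{diag}(p_{2j+1,0},\overline{p_{2j+1,1}},p_{2j+1,2},\overline{p_{2j+1,3}},\dots)$, $D_r(j)=\mathrm{diag}(1,\overline{p_{2j,1}},1,\overline{p_{2j,3}},\dots)$; this is the transfer matrix from column $2j$ to column $2j+2$ of solutions of $U(p)\psi=z\psi$. Let $P_{2L}(z)=A_z(L-1)A_z(L-2)\cdots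 A_z(-L)$, and let $\|\wedge^MP_{2L}(z)\|$ be the operator norm of its $M$-th exterior power on $\wedge^M\mathbb C^{2M}$, for which the vectors $e_{i_1}\wedge\dots\wedge e_{i_M}$ $(i_1<\dots<i_M)$ are orthonormal. **Lemma.** 0. For all $p$ and $L$, $\mu_L^{(M)}$ is a probability measure on $\mathbb T$, and $$\frac{1}{(4L+1)2M}\,\mathrm{tr}\,f(U^D)=\int_{\mathbb T}f(x)\,d\mu_L^{(M)}(x)\qquad(f\in C(\mathbb T)).$$ 1. For almost every $p$, $\mu_L^{(M)}\to dl$ vaguely as $L\to\infty$: $\int f\,d\mu_L^{(M)}\to\int f\,dl$ for all $f\in C(\mathbb T)$. Thus the density of states is flat. 2. There is a constant $c_M>0$ depending only on $M$ such that for all $r,t$ as above, all phases $p$, all integers $L\ge1$ and all $0\ne z\in\mathbb C\setminus\mathbb T$, $$\frac{1}{4LM}\log\bigl\|\wedge^MP_{2L}(z)\bigr\|\ \ge\ \frac12\log\frac1{rt}+\Bigl(2+\frac1{2L}\Bigr)\int_{\mathbb T}\log|z-x|\,d\mu_L^{(M)}(x)-\Bigl(1+\frac1{4L}\Bigr)\log|z|-\frac{c_M\,(1+|\log|z||)}{L}.$$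 -/

import Mathlib

open scoped Matrix.Norms.L2Operator

/-- The Borel structure on the unit circle `𝕋`. -/
noncomputable instance Circle.instMeasurableSpaceBorel : MeasurableSpace Circle := borel Circle

instance Circle.instBorelSpaceBorel : BorelSpace Circle := ⟨rfl⟩

namespace ChalkerCoddington

noncomputable section

/-! ### The random network operator on the cylinder `ℤ × ℤ_{2M}`

The discrete circle `ℤ_{2M}` is `Fin (2 * M)`, whose addition and subtraction are modulo `2M`
(so `k + 1`, `k - 1` are the cyclic neighbours); the parity of `k` is the parity of its
representative in `{0, …, 2M - 1}`. -/

/-- The sites of the cylinder `ℤ × ℤ_{2M}`. -/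
abbrev Site (M : ℕ) : Type := ℤ × Fin (2 * M)

/-- A realisation of the disorder: one phase in `𝕋` per site. -/
abbrev Phases (M : ℕ) : Type := Site M → Circle

/-- The normalised Lebesgue (Haar) measure `dl` on `𝕋`. -/
def dl : MeasureTheory.Measure Circle := MeasureTheory.Measure.haarMeasure ⊤

instance : MeasureTheory.IsProbabilityMeasure dl :=
  ⟨MeasureTheory.Measure.haarMeasure_self (K₀ := ⊤)⟩

/-- The law of the disorder: the phases are independent and uniformly distributed. -/
def phaseLaw (M : ℕ) : MeasureTheory.Measure (Phases M) :=
  MeasureTheory.Measure.infinitePi fun _ => dl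

/-- The image `𝕊 e_{n,k}` of a canonical basis vector under the network operator all of whose
phases are one. At the node met by the two incoming links the scattering matrix is
`[[t, -r], [r, t]]`:
* even nodes: incoming `(2j, 2k)`, `(2j+1, 2k+1)`, outgoing `(2j+1, 2k)`, `(2j, 2k+1)`;
* odd nodes: incoming `(2j+2, 2k+1)`, `(2j+1, 2k+2)`, outgoing `(2j+2, 2k+2)`, `(2j+1, 2k+1)`. -/
def freeStep {M : ℕ} [NeZero M] (r t : ℝ) (ν : Site M) : Site M → ℂ :=
  let n := ν.1
  let k := ν.2
  if Even n then
    if Even (k : ℕ) then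
      Pi.single (n + 1, k) (t : ℂ) + Pi.single (n, k + 1) (r : ℂ)
    else
      Pi.single (n, k + 1) (t : ℂ) + Pi.single (n - 1, k) (r : ℂ)
  else
    if Even (k : ℕ) then
      Pi.single (n + 1, k) (-(r : ℂ)) + Pi.single (n, k - 1) (t : ℂ)
    else
      Pi.single (n, k - 1) (-(r : ℂ)) + Pi.single (n - 1, k) (t : ℂ)

/-- The matrix elements `U(p)_{μ,ν}` of the network operator `U(p) = D(p) 𝕊` on
`l²(ℤ × ℤ_{2M})`, where `D(p)` is the diagonal operator with entries `p μ`. -/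
def networkEntry {M : ℕ} [NeZero M] (r t : ℝ) (p : Phases M) (μ ν : Site M) : ℂ :=
  (p μ : ℂ) * freeStep r t ν μ

/-! ### The truncation with reflecting boundary conditions and its density of states -/

/-- The sites of the finite cylinder `{-2L, …, 2L} × ℤ_{2M}`. -/
abbrev Box (L M : ℕ) : Type := Finset.Icc (-(2 * (L : ℤ))) (2 * (L : ℤ)) × Fin (2 * M)

/-- The site of the infinite cylinder underlying a site of the finite one. -/
def Box.toSite {L M : ℕ} (μ : Box L M) : Site M := (μ.1, μ.2)

/-- The restriction `U^D` of `U(p)` to the finite cylinder with reflecting boundary conditions: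
the links which are incoming to the walls at `±(2L+1)` are reflected,
`U^D e_{-2L,2k+1} = e_{-2L,2k+2}` and `U^D e_{2L,2k} = e_{2L,2k+1}`; all the other
matrix elements are those of `U(p)`. -/
def reflected {M : ℕ} [NeZero M] (r t : ℝ) (p : Phases M) (L : ℕ) :
    Matrix (Box L M) (Box L M) ℂ :=
  Matrix.of fun μ ν =>
    if (ν.toSite.1 = -(2 * (L : ℤ)) ∧ Odd (ν.2 : ℕ)) ∨
        (ν.toSite.1 = 2 * (L : ℤ) ∧ Even (ν.2 : ℕ)) then
      if μ = (ν.1, ν.2 + 1) then 1 else 0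
    else networkEntry r t p μ.toSite ν.toSite

/-- The finite-volume density of states `μ_L^{(M)}`: the normalised counting measure on `𝕋` of the
`(4L+1)2M` eigenvalues of the unitary matrix `U^D`, repeated according to multiplicity. (The
sum of point masses is a measure on `ℂ`; `comap` regards it as a measure on `𝕋 ⊆ ℂ`.) -/
def densityOfStates {M : ℕ} [NeZero M] (r t : ℝ) (p : Phases M) (L : ℕ) :
    MeasureTheory.Measure Circle :=
  ((((4 * L + 1) * (2 * M) : ℕ) : ENNReal)⁻¹) •
    (((reflected r t p L).charpoly.roots.map MeasureTheory.Measure.dirac).sum).comap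
      (fun x : Circle => (x : ℂ))

/-! ### Transfer matrices -/

/-- The block matrix `M₁(z)`, with `M` diagonal blocks `t⁻¹ [[z⁻¹, -r], [-r, z]]` in the
coordinates `(2k, 2k+1)`. -/
def transferEven {M : ℕ} [NeZero M] (r t : ℝ) (z : ℂ) :
    Matrix (Fin (2 * M)) (Fin (2 * M)) ℂ :=
  Matrix.of fun i j => (t : ℂ)⁻¹ *
    if Even (i : ℕ) then (if j = i then z⁻¹ else if j = i + 1 then -(r : ℂ) else 0)
    else (if j = i then z else if j = i - 1 then -(r : ℂ) else 0)

/-- The block matrix `M₂(z)`, with `M` blocks `r⁻¹ [[z, -t], [t, -z⁻¹]]` in the (cyclic)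
coordinates `(2k+1, 2k+2)`. -/
def transferOdd {M : ℕ} [NeZero M] (r t : ℝ) (z : ℂ) :
    Matrix (Fin (2 * M)) (Fin (2 * M)) ℂ :=
  Matrix.of fun i j => (r : ℂ)⁻¹ *
    if Even (i : ℕ) then (if j = i then -z⁻¹ else if j = i - 1 then (t : ℂ) else 0)
    else (if j = i then z else if j = i + 1 then -(t : ℂ) else 0)

/-- An element `(p₀, …, p_{2M-1}; p_{2M}, …, p_{4M-1})` of `𝕋^{4M}`: the phases entering one
generator of the cocycle. -/
abbrev CellPhases (M : ℕ) : Type := (Fin (2 * M) → Circle) × (Fin (2 * M) → Circle)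

/-- The generator `A_z = D(p_l) M₂(z) D(p_m) M₁(z) D(p_r)` with
`p_l = (p₀, 1, p₂, 1, …)`, `p_r = (1, p₁, 1, p₃, …)` and `p_m = (p_{2M}, …, p_{4M-1})`. -/
def generator {M : ℕ} [NeZero M] (r t : ℝ) (z : ℂ) (q : CellPhases M) :
    Matrix (Fin (2 * M)) (Fin (2 * M)) ℂ :=
  Matrix.diagonal (fun k : Fin (2 * M) => if Even (k : ℕ) then (q.1 k : ℂ) else 1) * transferOdd r t z *
    Matrix.diagonal (fun k => (q.2 k : ℂ)) * transferEven r t z *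
    Matrix.diagonal (fun k : Fin (2 * M) => if Even (k : ℕ) then 1 else (q.1 k : ℂ))

/-- `Φ_z(n, ω) = A(ω (n-1)) ⋯ A(ω 0)` for `n ≥ 0`. -/
def cocycleForward {M : ℕ} [NeZero M] (r t : ℝ) (z : ℂ) (ω : ℤ → CellPhases M) :
    ℕ → Matrix (Fin (2 * M)) (Fin (2 * M)) ℂ
  | 0 => 1
  | n + 1 => generator r t z (ω (n : ℤ)) * cocycleForward r t z ω n

/-- `Φ_z(-n, ω) = A(ω (-n))⁻¹ ⋯ A(ω (-1))⁻¹` for `n ≥ 0`. -/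
def cocycleBackward {M : ℕ} [NeZero M] (r t : ℝ) (z : ℂ) (ω : ℤ → CellPhases M) :
    ℕ → Matrix (Fin (2 * M)) (Fin (2 * M)) ℂ
  | 0 => 1
  | n + 1 => (generator r t z (ω (-((n : ℤ) + 1))))⁻¹ * cocycleBackward r t z ω n

/-- The phases entering the transfer matrix from column `2j` to column `2j+2`. Solving
`U(p) ψ = z ψ` for the column `ψ_{2j+2}` in terms of `ψ_{2j}` gives
`ψ_{2j+2} = A_z(cellPhases p j) ψ_{2j}`. -/
def cellPhases {M : ℕ} (p : Phases M) (j : ℤ) : CellPhases M :=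
  (fun k => if Even (k : ℕ) then p (2 * j + 2, k) else (p (2 * j, k))⁻¹,
   fun k => if Even (k : ℕ) then p (2 * j + 1, k) else (p (2 * j + 1, k))⁻¹)

/-- The propagator `P_{2L}(z) = Φ_z(L) Φ_z(-L)⁻¹` from column `-2L` to column `2L`. -/
def propagator {M : ℕ} [NeZero M] (r t : ℝ) (p : Phases M) (z : ℂ) (L : ℕ) :
    Matrix (Fin (2 * M)) (Fin (2 * M)) ℂ :=
  cocycleForward r t z (cellPhases p) L * (cocycleBackward r t z (cellPhases p) L)⁻¹

/-- The norm `‖∧^m B‖` of the `m`-th exterior power of a matrix: the operator norm on `∧^m ℂⁿ`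
with the Hermitian structure for which the vectors `e_{i₁} ∧ ⋯ ∧ e_{i_m}`, `i₁ < ⋯ < i_m`, form an
orthonormal basis (the matrix norm used here is the `ℓ²` operator norm). -/
def exteriorPowerNorm {n : ℕ} (m : ℕ) (B : Matrix (Fin n) (Fin n) ℂ) : ℝ :=
  ‖LinearMap.toMatrix ((Pi.basisFun ℂ (Fin n)).exteriorPower m)
    ((Pi.basisFun ℂ (Fin n)).exteriorPower m) (exteriorPower.map m (Matrix.toLin' B))‖

end

end ChalkerCoddington

/-!
The `n`-th moment of `μ_L` is the normalized trace of `(U^D)^n`. Up to boundary terms of bounded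
size, this trace is the sum over the columns of the diagonal elements of `U(p)^n`. The contribution
of one column is multiplied by `c^n` when all phases are multiplied by `c`, hence has mean zero for
`n ≠ 0`; its law is invariant under translation by an even number of columns; and it depends only on
phases within distance `n`. The contributions of sufficiently distant columns are thus i.i.d., and
the strong law of large numbers, applied along residue classes of columns, makes every moment with
`n ≠ 0` vanish in the limit. Trigonometric polynomials are dense in `C(𝕋)`.

For the lower bound, number the equations `(z - U^D) ψ = 0` so that each group couples two
neighbouring columns. Then `z - U^D` is block bidiagonal, closed up by the equations at the two
walls, and eliminating the interior columns with transfer matrices gives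
`|det (z - U^D)| = (|z|² r t)^(2LM) |det B|`, where `M` rows of the `2M × 2M` matrix `B` have the
form `z e_k - e_{k-1}` and the other `M` rows are formed in the same way from the rows of
`P_{2L}(z)`. Expanding along all rows writes `det B` in terms of minors of `P_{2L}(z)` of order `M`,
which are bounded by `‖∧^M P_{2L}(z)‖`, and `log |det (z - U^D)|` is `(4L + 1) 2M` times the
integral of `log |z - x|` against `μ_L`.
-/

namespace ChalkerCoddington

open scoped Matrix

section Spectral

open Polynomial

variable {n K : Type*} [Fintype n] [DecidableEq n] [Field K] [IsAlgClosed K]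

theorem det_aeval_eq_prod_roots (A : Matrix n n K) (q : K[X]) :
    (aeval A q).det = (A.charpoly.roots.map fun x => q.eval x).prod := by
  let F : K[X] →* K := Matrix.detMonoidHom.comp (aeval A : K[X] →ₐ[K] Matrix n n K).toMonoidHom
  let G : K[X] →* K :=
    { toFun := fun q => (A.charpoly.roots.map fun x => q.eval x).prod
      map_one' := by simp
      map_mul' := fun q q' => by simp [Multiset.prod_map_mul] }
  have hcard : Multiset.card A.charpoly.roots = Fintype.card n := by
    rw [← (IsAlgClosed.splits A.charpoly).natDegree_eq_card_roots, A.charpoly_natDegree_eq_dim]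
  have hconst : ∀ a : K, F (C a) = G (C a) := fun a => by
    simp [F, G, hcard, Matrix.algebraMap_eq_diagonal, Pi.algebraMap_def]
  have hlinear : ∀ a : K, F (X + C a) = G (X + C a) := fun a => by
    have hF : aeval A (X + C a) = -(Matrix.scalar n (-a) - A) := by
      rw [map_add, aeval_X, aeval_C, map_neg, neg_sub, sub_neg_eq_add]
      rfl
    have hG : ∀ x, (X + C a).eval x = -1 * (-a - x) := fun x => by simp [add_comm]
    change (aeval A (X + C a)).det = (A.charpoly.roots.map fun x => (X + C a).eval x).prod
    rw [hF, Matrix.det_neg, ← Matrix.eval_charpoly,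
      (IsAlgClosed.splits A.charpoly).eval_eq_prod_roots_of_monic A.charpoly_monic]
    simp only [hG, Multiset.prod_map_mul, Multiset.map_const', Multiset.prod_replicate, hcard]
  refine MonoidHom.eqOn_closureM (f := F) (g := G) ?_ (IsAlgClosed.splits q)
  rintro _ (⟨a, rfl⟩ | ⟨a, rfl⟩)
  exacts [hconst a, hlinear a]

theorem roots_charpoly_aeval (A : Matrix n n K) (q : K[X]) :
    (aeval A q).charpoly.roots = A.charpoly.roots.map fun x => q.eval x := by
  have hcharpoly : (aeval A q).charpoly =
      ((A.charpoly.roots.map fun x => q.eval x).map fun a => X - C a).prod := by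
    refine Polynomial.funext fun c => ?_
    have hscalar : Matrix.scalar n c - aeval A q = aeval A (C c - q) := by
      simp [Matrix.scalar_apply, Matrix.algebraMap_eq_diagonal, Pi.algebraMap_def]
    rw [Matrix.eval_charpoly, hscalar, det_aeval_eq_prod_roots]
    simp [eval_multiset_prod]
  rw [hcharpoly, roots_multiset_prod_X_sub_C]

theorem trace_aeval_eq_sum_roots (A : Matrix n n K) (q : K[X]) :
    (aeval A q).trace = (A.charpoly.roots.map fun x => q.eval x).sum := by
  rw [Matrix.trace_eq_sum_roots_charpoly, roots_charpoly_aeval]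

theorem trace_pow_eq_sum_roots (A : Matrix n n K) (k : ℕ) :
    (A ^ k).trace = (A.charpoly.roots.map (· ^ k)).sum := by
  simpa using trace_aeval_eq_sum_roots A (X ^ k)

theorem trace_cfc_eq_sum_roots {A : Matrix n n ℂ} (hA : IsStarNormal A) (f : ℂ → ℂ) :
    (cfc f A).trace = (A.charpoly.roots.map f).sum := by
  set s := A.charpoly.roots.toFinset
  let q : ℂ[X] := Lagrange.interpolate s id f
  have hq : ∀ x ∈ A.charpoly.roots, q.eval x = f x := fun x hx =>
    Lagrange.eval_interpolate_at_node (v := id) f Function.injective_id.injOn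
      (Multiset.mem_toFinset.mpr hx)
  have hcfc : cfc f A = aeval A q := by
    rw [← cfc_polynomial q A hA]
    refine cfc_congr fun x hx => (hq x ?_).symm
    rw [Matrix.mem_spectrum_iff_isRoot_charpoly] at hx
    exact (mem_roots A.charpoly_monic.ne_zero).mpr hx
  rw [hcfc, trace_aeval_eq_sum_roots, Multiset.map_congr rfl hq]

end Spectral

section ExteriorPower

variable {n m : ℕ}

theorem norm_entry_le_l2_opNorm {ι κ : Type*} [Fintype ι] [Fintype κ] [DecidableEq κ]
    (A : Matrix ι κ ℂ) (i : ι) (j : κ) : ‖A i j‖ ≤ ‖A‖ := by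
  calc ‖A i j‖ = ‖(WithLp.toLp 2 (A *ᵥ EuclideanSpace.single j (1 : ℂ))) i‖ := by simp
    _ ≤ ‖WithLp.toLp 2 (A *ᵥ EuclideanSpace.single j (1 : ℂ))‖ := PiLp.norm_apply_le _ i
    _ ≤ ‖A‖ * ‖EuclideanSpace.single j (1 : ℂ)‖ := Matrix.l2_opNorm_mulVec A _
    _ = ‖A‖ := by simp

theorem toMatrix_exteriorPower_map_apply (m : ℕ) (B : Matrix (Fin n) (Fin n) ℂ)
    (s t : Set.powersetCard (Fin n) m) :
    LinearMap.toMatrix ((Pi.basisFun ℂ (Fin n)).exteriorPower m)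
      ((Pi.basisFun ℂ (Fin n)).exteriorPower m) (exteriorPower.map m (Matrix.toLin' B)) s t =
    (B.submatrix (Set.powersetCard.ofFinEmbEquiv.symm s)
      (Set.powersetCard.ofFinEmbEquiv.symm t)).det := by
  rw [LinearMap.toMatrix_apply, exteriorPower.basis_apply, exteriorPower.map_apply_ιMulti_family,
    exteriorPower.basis_repr_apply, exteriorPower.ιMulti_family,
    exteriorPower.ιMultiDual_apply_ιMulti, ← Matrix.det_transpose]
  congr 1
  ext i j
  simp

theorem norm_det_submatrix_orderEmb_le (B : Matrix (Fin n) (Fin n) ℂ) (a b : Fin m ↪o Fin n) :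
    ‖(B.submatrix a b).det‖ ≤ exteriorPowerNorm m B := by
  have h := norm_entry_le_l2_opNorm (LinearMap.toMatrix ((Pi.basisFun ℂ (Fin n)).exteriorPower m)
      ((Pi.basisFun ℂ (Fin n)).exteriorPower m) (exteriorPower.map m (Matrix.toLin' B)))
      (Set.powersetCard.ofFinEmbEquiv a) (Set.powersetCard.ofFinEmbEquiv b)
  rw [toMatrix_exteriorPower_map_apply, Equiv.symm_apply_apply, Equiv.symm_apply_apply] at h
  convert! h

theorem exists_orderEmb_comp_perm_eq {α : Type*} [LinearOrder α] {a : Fin m → α}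
    (ha : Function.Injective a) : ∃ (σ : Equiv.Perm (Fin m)) (a' : Fin m ↪o α), a' ∘ σ = a :=
  ⟨(Tuple.sort a)⁻¹, OrderEmbedding.ofStrictMono (a ∘ Tuple.sort a)
    ((Tuple.monotone_sort a).strictMono_of_injective (ha.comp (Equiv.injective _))),
    by ext; simp⟩

theorem norm_det_submatrix_equiv_equiv {ι κ : Type*} [Fintype ι] [DecidableEq ι] [Fintype κ]
    [DecidableEq κ] (e f : ι ≃ κ) (A : Matrix κ κ ℂ) : ‖(A.submatrix e f).det‖ = ‖A.det‖ := by
  have h : A.submatrix e f = (A.submatrix id (e.symm.trans f)).submatrix e e := by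
    ext; simp
  rw [h, Matrix.det_submatrix_equiv_self, Matrix.det_permute']
  rcases Int.units_eq_one_or (Equiv.Perm.sign (e.symm.trans f)) with h | h <;> simp [h]

theorem norm_det_submatrix_le_exteriorPowerNorm {ι : Type*} [Fintype ι] [DecidableEq ι]
    (B : Matrix (Fin n) (Fin n) ℂ) (a b : ι → Fin n) :
    ‖(B.submatrix a b).det‖ ≤ exteriorPowerNorm (Fintype.card ι) B := by
  have hnonneg : 0 ≤ exteriorPowerNorm (Fintype.card ι) B := norm_nonneg _
  by_cases ha : Function.Injective a
  swap
  · obtain ⟨i, j, hij, hne⟩ := Function.not_injective_iff.mp ha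
    rwa [Matrix.det_zero_of_row_eq hne (by ext k; simp [hij]), norm_zero]
  by_cases hb : Function.Injective b
  swap
  · obtain ⟨i, j, hij, hne⟩ := Function.not_injective_iff.mp hb
    rwa [Matrix.det_zero_of_column_eq hne (by intro k; simp [hij]), norm_zero]
  let e := (Fintype.equivFin ι).symm
  obtain ⟨σ, a', ha'⟩ := exists_orderEmb_comp_perm_eq (ha.comp e.injective)
  obtain ⟨τ, b', hb'⟩ := exists_orderEmb_comp_perm_eq (hb.comp e.injective)
  rw [← Matrix.det_submatrix_equiv_self e, Matrix.submatrix_submatrix, ← ha', ← hb',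
    ← Matrix.submatrix_submatrix, norm_det_submatrix_equiv_equiv]
  exact norm_det_submatrix_orderEmb_le B a' b'

end ExteriorPower

section Determinant

theorem norm_det_sum_smul_rows_le {ι κ : Type*} [Fintype ι] [DecidableEq ι] [Fintype κ]
    (c : ι → κ → ℂ) (Q : ι → κ → ι → ℂ) {K : ℝ}
    (hK : ∀ f : ι → κ, ‖(Matrix.of fun i => Q i (f i)).det‖ ≤ K) :
    ‖(Matrix.of fun i => ∑ j, c i j • Q i j).det‖ ≤ (∏ i, ∑ j, ‖c i j‖) * K := by
  classical
  have hexpand : (Matrix.of fun i => ∑ j, c i j • Q i j).det =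
      ∑ f : ι → κ, (∏ i, c i (f i)) * (Matrix.of fun i => Q i (f i)).det := by
    let D := (Matrix.detRowAlternating (n := ι) (R := ℂ)).toMultilinearMap
    refine (D.map_sum fun i j => c i j • Q i j).trans (Finset.sum_congr rfl fun f _ => ?_)
    exact D.map_smul_univ (fun i => c i (f i)) fun i => Q i (f i)
  calc ‖(Matrix.of fun i => ∑ j, c i j • Q i j).det‖
      ≤ ∑ f : ι → κ, ‖(∏ i, c i (f i)) * (Matrix.of fun i => Q i (f i)).det‖ :=
        hexpand ▸ norm_sum_le _ _
    _ ≤ ∑ f : ι → κ, (∏ i, ‖c i (f i)‖) * K := by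
        gcongr with f
        rw [norm_mul, norm_prod]
        gcongr
        exact hK f
    _ = (∏ i, ∑ j, ‖c i j‖) * K := by
        rw [Finset.prod_univ_sum, Finset.sum_mul, Fintype.piFinset_univ]

theorem norm_det_rows_one_or_le_exteriorPowerNorm_of_injOn {n : ℕ} (P : Matrix (Fin n) (Fin n) ℂ)
    {p : Fin n → Prop} [DecidablePred p] {a : Fin n → Fin n} (ha : Set.InjOn a {k | p k}) :
    ‖(Matrix.of fun k => if p k then (1 : Matrix (Fin n) (Fin n) ℂ) (a k) else P (a k)).det‖ ≤
      exteriorPowerNorm (Fintype.card {k // ¬p k}) P := by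
  classical
  set N := Matrix.of fun k => if p k then (1 : Matrix (Fin n) (Fin n) ℂ) (a k) else P (a k)
  let e : {k // p k} ≃ {i // i ∈ a '' {k | p k}} := Equiv.Set.imageOfInjOn a {k | p k} ha
  let σ : Equiv.Perm (Fin n) := e.extendSubtype
  have hσ : ∀ k, p k → σ k = a k := fun k hk => e.extendSubtype_apply_of_mem k hk
  have hrow : ∀ k, p k → ∀ l, N.submatrix id σ k l = (1 : Matrix (Fin n) (Fin n) ℂ) k l := by
    intro k hk l
    simp [N, hk, ← hσ k hk, Matrix.one_apply]
  have hblock : (N.submatrix id σ).toSquareBlockProp p = 1 := by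
    ext k l
    exact (hrow k k.2 l).trans (by simp [Matrix.one_apply, Subtype.ext_iff])
  have hblock' : (N.submatrix id σ).toSquareBlockProp (fun k => ¬p k) =
      P.submatrix (fun k : {k // ¬p k} => a k) (fun k : {k // ¬p k} => σ k) := by
    ext k l
    simp [Matrix.toSquareBlockProp_def, N, k.2]
  rw [← norm_det_submatrix_equiv_equiv (Equiv.refl _) σ, Equiv.coe_refl,
    Matrix.twoBlockTriangular_det' _ p, hblock, hblock', Matrix.det_one, one_mul]
  · exact norm_det_submatrix_le_exteriorPowerNorm P _ _
  · intro k hk l hl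
    rw [hrow k hk, Matrix.one_apply_ne]
    rintro rfl
    exact hl hk

theorem norm_det_rows_one_or_le_exteriorPowerNorm {n : ℕ} (P : Matrix (Fin n) (Fin n) ℂ)
    (p : Fin n → Prop) [DecidablePred p] (a : Fin n → Fin n) :
    ‖(Matrix.of fun k => if p k then (1 : Matrix (Fin n) (Fin n) ℂ) (a k) else P (a k)).det‖ ≤
      exteriorPowerNorm (Fintype.card {k // ¬p k}) P := by
  by_cases ha : Set.InjOn a {k | p k}
  · exact norm_det_rows_one_or_le_exteriorPowerNorm_of_injOn P ha
  · simp only [Set.InjOn, not_forall] at ha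
    obtain ⟨k, hk, l, hl, hkl, hne⟩ := ha
    rw [Matrix.det_zero_of_row_eq hne, norm_zero]
    · exact norm_nonneg _
    · funext j
      simp only [Matrix.of_apply, if_pos (show p k from hk), if_pos (show p l from hl)]
      rw [hkl]

end Determinant

section CyclicBidiagonal

variable {κ R : Type*} [Fintype κ] [DecidableEq κ] [CommRing R] {N : ℕ}

theorem det_comp_of_blockTriangular {m α : Type*} [Fintype m] [DecidableEq m] [LinearOrder α]
    (b : m ≃ α) {A : Matrix m m (Matrix κ κ R)} (hA : A.BlockTriangular b) :
    (Matrix.comp m m κ κ R A).det = ∏ i, (A i i).det := by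
  have := Fintype.ofEquiv m b
  rw [hA.comp.det_fintype, ← Equiv.prod_comp b]
  refine Finset.prod_congr rfl fun i _ => ?_
  let e : κ ≃ {x : m × κ // b x.1 = b i} :=
    { toFun := fun k => ⟨(i, k), rfl⟩
      invFun := fun x => x.1.2
      left_inv := fun _ => rfl
      right_inv := fun ⟨x, hx⟩ => Subtype.ext (Prod.ext (b.injective hx).symm rfl) }
  rw [← Matrix.det_submatrix_equiv_self e]
  rfl

/-- The block matrix of the system `B i * ψ (i + 1) = A i * ψ i` for a sequence `ψ 0, …, ψ N` of
column vectors, closed up by the boundary condition `C₀ * ψ 0 + C₁ * ψ N = 0` as its first row. -/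
def cyclicBidiagonal (C₀ C₁ : Matrix κ κ R) (A B : Fin N → Matrix κ κ R) :
    Matrix (Fin (N + 1)) (Fin (N + 1)) (Matrix κ κ R) :=
  Matrix.of (Fin.cons (Pi.single 0 C₀ + Pi.single (Fin.last N) C₁)
    fun i => Pi.single i.succ (B i) - Pi.single i.castSucc (A i))

theorem det_cyclicBidiagonal (C₀ C₁ : Matrix κ κ R) {A B : Fin N → Matrix κ κ R}
    {P : Fin (N + 1) → Matrix κ κ R} (hP₀ : P 0 = 1)
    (hP : ∀ i : Fin N, B i * P i.succ = A i * P i.castSucc) :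
    (Matrix.comp _ _ _ _ R (cyclicBidiagonal C₀ C₁ A B)).det =
      (C₀ + C₁ * P (Fin.last N)).det * ∏ i, (B i).det := by
  -- `S` is the substitution `ψ i = P i * ψ 0 + φ i`, which makes the system block triangular.
  let S : Matrix (Fin (N + 1)) (Fin (N + 1)) (Matrix κ κ R) :=
    Matrix.of fun i j => if j = 0 then P i else if i = j then 1 else 0
  set D := cyclicBidiagonal C₀ C₁ A B
  have hS : (Matrix.compRingEquiv _ _ R S).det = 1 := by
    rw [Matrix.compRingEquiv_apply, det_comp_of_blockTriangular OrderDual.toDual]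
    · refine Finset.prod_eq_one fun i _ => ?_
      cases i using Fin.cases <;> simp [S, hP₀]
    · intro i j (hij : i < j)
      simp [S, hij.ne, Fin.ne_zero_of_lt hij]
  have hzero : (D * S) 0 0 = C₀ + C₁ * P (Fin.last N) := by
    simp [D, S, cyclicBidiagonal, Matrix.mul_apply, add_mul, Finset.sum_add_distrib,
      Pi.single_apply, hP₀]
  have hsucc_zero : ∀ i : Fin N, (D * S) i.succ 0 = 0 := by
    simp [D, S, cyclicBidiagonal, Matrix.mul_apply, sub_mul, Finset.sum_sub_distrib,
      Pi.single_apply, hP]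
  have hsucc_succ : ∀ i j : Fin N, (D * S) i.succ j.succ =
      (if j = i then B i else 0) - if j.succ = i.castSucc then A i else 0 := by
    simp [D, S, cyclicBidiagonal, Matrix.mul_apply, Pi.single_apply]
  rw [← mul_one (Matrix.det _), ← hS, ← Matrix.compRingEquiv_apply, ← Matrix.det_mul, ← map_mul,
    Matrix.compRingEquiv_apply, det_comp_of_blockTriangular (Equiv.neg _), Fin.prod_univ_succ,
    hzero]
  · simp [hsucc_succ, Fin.ext_iff]
  · intro i j hij
    simp only [Equiv.neg_apply, Fin.lt_def, Fin.val_neg'] at hij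
    cases j using Fin.cases <;> cases i using Fin.cases
    · simp at hij
    · exact hsucc_zero _
    · simp at hij
    · rw [Fin.val_succ, Fin.val_succ, Nat.mod_eq_of_lt (by lia), Nat.mod_eq_of_lt (by lia)] at hij
      rw [hsucc_succ, if_neg (by grind), if_neg (by grind), sub_zero]

end CyclicBidiagonal

section Network

variable {M : ℕ} {r t : ℝ}

/-- The site of a neighbouring column which is scattered into `μ` by the free network operator. -/
def axialSource (μ : Site M) : Site M :=
  (if Even (μ.2 : ℕ) then μ.1 - 1 else μ.1 + 1, μ.2)

/-- The amplitude with which `ringSource μ` is scattered into `μ`. -/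
def ringAmp (r t : ℝ) (μ : Site M) : ℝ :=
  if Even μ.1 then (if Even (μ.2 : ℕ) then t else r) else (if Even (μ.2 : ℕ) then -r else t)

/-- The amplitude with which `axialSource μ` is scattered into `μ`. -/
def axialAmp (r t : ℝ) (μ : Site M) : ℝ :=
  if Even μ.1 then (if Even (μ.2 : ℕ) then -r else t) else (if Even (μ.2 : ℕ) then t else r)

theorem axialSource_injective : Function.Injective (axialSource (M := M)) := by
  rintro ⟨n, k⟩ ⟨n', k'⟩ h
  simp only [axialSource, Prod.mk.injEq] at h
  obtain ⟨h, rfl⟩ := h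
  by_cases hk : Even (k : ℕ) <;> simpa [hk] using h

theorem ringAmp_sq_add_axialAmp_sq (h : r ^ 2 + t ^ 2 = 1) (μ : Site M) :
    ringAmp r t μ ^ 2 + axialAmp r t μ ^ 2 = 1 := by
  grind [ringAmp, axialAmp]

variable [NeZero M]

theorem even_val_add_one (k : Fin (2 * M)) :
    Even ((k + 1 : Fin (2 * M)) : ℕ) ↔ ¬Even (k : ℕ) := by
  have hM : 0 < M := NeZero.pos M
  have hone : ((1 : Fin (2 * M)) : ℕ) = 1 := by
    rw [Fin.val_one', Nat.mod_eq_of_lt (by lia)]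
  rw [Fin.val_add, hone]
  rcases Nat.lt_or_ge ((k : ℕ) + 1) (2 * M) with h | h
  · rw [Nat.mod_eq_of_lt h, Nat.even_add_one]
  · have hk : (k : ℕ) + 1 = 2 * M := by lia
    rw [hk, Nat.mod_self, ← Nat.even_add_one, hk]
    simp

theorem even_val_sub_one (k : Fin (2 * M)) :
    Even ((k - 1 : Fin (2 * M)) : ℕ) ↔ ¬Even (k : ℕ) := by
  have h := even_val_add_one (k - 1)
  rw [sub_add_cancel] at h
  tauto

/-- The site of the same column which is scattered into `μ` by the free network operator. -/
def ringSource (μ : Site M) : Site M :=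
  (μ.1, if Even μ.1 then μ.2 - 1 else μ.2 + 1)

theorem freeStep_apply (r t : ℝ) (μ ν : Site M) :
    freeStep r t ν μ = (if ν = ringSource μ then (ringAmp r t μ : ℂ) else 0) +
      if ν = axialSource μ then (axialAmp r t μ : ℂ) else 0 := by
  obtain ⟨n, k⟩ := μ
  obtain ⟨n', k'⟩ := ν
  have hk := even_val_add_one k
  have hk' := even_val_sub_one k
  have hadd : k = k' + 1 ↔ k' = k - 1 := by rw [eq_sub_iff_add_eq, eq_comm]
  have hsub : k = k' - 1 ↔ k' = k + 1 := by rw [eq_sub_iff_add_eq, eq_comm]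
  simp only [freeStep, ringSource, axialSource, ringAmp, axialAmp]
  by_cases hn : Even n <;> by_cases hn' : Even n' <;>
    by_cases h : Even (k : ℕ) <;> by_cases h' : Even (k' : ℕ) <;>
    simp only [hn, hn', h, h', if_true, if_false, Pi.add_apply, Pi.single_apply, Prod.mk.injEq,
      Complex.ofReal_neg] <;>
    grind

theorem ringSource_injective : Function.Injective (ringSource (M := M)) := by
  rintro ⟨n, k⟩ ⟨n', k'⟩ h
  simp only [ringSource, Prod.mk.injEq] at h
  obtain ⟨rfl, h⟩ := h
  by_cases hn : Even n <;> simpa [hn] using h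

theorem ringSource_ne_axialSource (μ : Site M) : ringSource μ ≠ axialSource μ := by
  grind [ringSource, axialSource]

theorem ringSource_eq_axialSource_comm {μ ν : Site M} :
    ringSource μ = axialSource ν ↔ ringSource ν = axialSource μ := by
  obtain ⟨n, k⟩ := μ
  obtain ⟨n', k'⟩ := ν
  have hk := even_val_add_one k
  have hk' := even_val_add_one k'
  simp only [ringSource, axialSource, Prod.mk.injEq]
  grind [sub_eq_iff_eq_add]

theorem ringAmp_mul_axialAmp_add_eq_zero {μ ν : Site M} (h : ringSource μ = axialSource ν) :
    ringAmp r t μ * axialAmp r t ν + axialAmp r t μ * ringAmp r t ν = 0 := by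
  obtain ⟨n, k⟩ := μ
  obtain ⟨n', k'⟩ := ν
  have hk := even_val_add_one k
  have hk' := even_val_sub_one k
  simp only [ringSource, axialSource, Prod.mk.injEq] at h
  simp only [ringAmp, axialAmp]
  grind

end Network

section Reflected

variable {M : ℕ} {L : ℕ}

/-- The sites of the finite cylinder which are reached by reflection at a wall: those which receive
an amplitude from outside of it under the free network operator. -/
def IsWall (L : ℕ) (μ : Site M) : Prop :=
  (axialSource μ).1 ∉ Finset.Icc (-(2 * (L : ℤ))) (2 * L)

noncomputable instance (L : ℕ) : DecidablePred (IsWall (M := M) L) := fun _ => instDecidableNot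

theorem toSite_injective : Function.Injective (Box.toSite (L := L) (M := M)) := by
  rintro ⟨n, k⟩ ⟨n', k'⟩ h
  simp only [Box.toSite, Prod.mk.injEq] at h
  exact Prod.ext (Subtype.ext h.1) h.2

theorem exists_toSite_eq_iff {μ : Site M} :
    (∃ ν : Box L M, ν.toSite = μ) ↔ μ.1 ∈ Finset.Icc (-(2 * (L : ℤ))) (2 * L) :=
  ⟨fun ⟨ν, hν⟩ => hν ▸ ν.1.2, fun h => ⟨(⟨μ.1, h⟩, μ.2), rfl⟩⟩

theorem IsWall.toSite_ne_axialSource {μ : Site M} (h : IsWall L μ) (ν : Box L M) :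
    ν.toSite ≠ axialSource μ :=
  fun hν => h (exists_toSite_eq_iff.mp ⟨ν, hν⟩)

theorem exists_toSite_eq_axialSource {μ : Site M} (h : ¬IsWall L μ) :
    ∃ ν : Box L M, ν.toSite = axialSource μ :=
  exists_toSite_eq_iff.mpr (not_not.mp h)

theorem isWall_toSite_iff (μ : Box L M) : IsWall L μ.toSite ↔
    (μ.toSite.1 = -(2 * (L : ℤ)) ∧ Even (μ.2 : ℕ)) ∨
      (μ.toSite.1 = 2 * (L : ℤ) ∧ Odd (μ.2 : ℕ)) := by
  have hμ := Finset.mem_Icc.mp μ.1.2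
  simp only [IsWall, axialSource, Box.toSite, Finset.mem_Icc, ← Nat.not_even_iff_odd]
  by_cases hk : Even (μ.2 : ℕ) <;> simp only [hk, if_true, if_false] <;> grind

theorem sum_ite_toSite_eq {R : Type*} [AddCommMonoid R] (μ : Box L M) (f : Box L M → R) :
    (∑ ν : Box L M, if ν.toSite = μ.toSite then f ν else 0) = f μ := by
  simp [toSite_injective.eq_iff]

variable {r t : ℝ} {p : Phases M}

/-- The matrix element of the reflected network matrix between `ringSource μ` and `μ`. -/
noncomputable def ringEntry (r t : ℝ) (p : Phases M) (L : ℕ) (μ : Site M) : ℂ :=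
  if IsWall L μ then 1 else p μ * ringAmp r t μ

/-- The matrix element of the reflected network matrix between `axialSource μ` and `μ`. -/
noncomputable def axialEntry (r t : ℝ) (p : Phases M) (L : ℕ) (μ : Site M) : ℂ :=
  if IsWall L μ then 0 else p μ * axialAmp r t μ

theorem ringEntry_mul_star_add_axialEntry_mul_star (h : r ^ 2 + t ^ 2 = 1) (μ : Site M) :
    ringEntry r t p L μ * star (ringEntry r t p L μ) +
      axialEntry r t p L μ * star (axialEntry r t p L μ) = 1 := by
  simp only [Complex.star_def, Complex.mul_conj']
  norm_cast
  rw [ringEntry, axialEntry]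
  split_ifs
  · simp
  · simpa [mul_pow, Circle.norm_coe] using ringAmp_sq_add_axialAmp_sq h μ

variable [NeZero M]

theorem exists_toSite_eq_ringSource (μ : Box L M) :
    ∃ ν : Box L M, ν.toSite = ringSource μ.toSite :=
  exists_toSite_eq_iff.mpr μ.1.2

theorem not_isWall_of_ringSource_eq_axialSource {μ : Box L M} {ν : Site M}
    (h : ringSource μ.toSite = axialSource ν) : ¬IsWall L ν := fun hν =>
  let ⟨ρ, hρ⟩ := exists_toSite_eq_ringSource μ
  hν.toSite_ne_axialSource ρ (hρ.trans h)

theorem ringSource_toSite_of_isWall {μ : Box L M} (h : IsWall L μ.toSite) :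
    ringSource μ.toSite = Box.toSite (μ.1, μ.2 - 1) := by
  have hcol : Even μ.toSite.1 := by
    rcases (isWall_toSite_iff μ).mp h with h | h <;> rw [h.1] <;> simp
  exact Prod.ext rfl (if_pos hcol)

theorem isWall_toSite_add_one_iff (ν : Box L M) :
    IsWall L (Box.toSite (L := L) (ν.1, ν.2 + 1)) ↔
      (ν.toSite.1 = -(2 * (L : ℤ)) ∧ Odd (ν.2 : ℕ)) ∨
        (ν.toSite.1 = 2 * (L : ℤ) ∧ Even (ν.2 : ℕ)) := by
  rw [isWall_toSite_iff]
  simp only [← Nat.not_even_iff_odd, even_val_add_one, not_not]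
  rfl

theorem reflected_apply (μ ν : Box L M) :
    reflected r t p L μ ν =
      (if ν.toSite = ringSource μ.toSite then ringEntry r t p L μ.toSite else 0) +
        if ν.toSite = axialSource μ.toSite then axialEntry r t p L μ.toSite else 0 := by
  simp only [reflected, Matrix.of_apply, ← isWall_toSite_add_one_iff]
  by_cases hν : IsWall L (Box.toSite (L := L) (ν.1, ν.2 + 1))
  · have hring : ringSource (Box.toSite (L := L) (ν.1, ν.2 + 1)) = ν.toSite := by
      rw [ringSource_toSite_of_isWall hν]
      simp
    have haxial : ν.toSite ≠ axialSource μ.toSite := fun h =>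
      not_isWall_of_ringSource_eq_axialSource
        (ringSource_eq_axialSource_comm.mp (hring.trans h)) hν
    rw [if_pos hν, if_neg haxial, add_zero]
    simp only [← hring, ringSource_injective.eq_iff, toSite_injective.eq_iff, eq_comm (a := μ)]
    split_ifs with h
    · rw [ringEntry, if_pos (h ▸ hν)]
    · rfl
  · rw [if_neg hν, networkEntry, freeStep_apply]
    by_cases hμ : IsWall L μ.toSite
    · have hring : ν.toSite ≠ ringSource μ.toSite := by
        rw [ringSource_toSite_of_isWall hμ, toSite_injective.ne_iff]
        rintro rfl
        simp [hμ] at hν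
      simp [hring, hμ.toSite_ne_axialSource ν]
    · simp only [ringEntry, axialEntry, if_neg hμ, mul_add, mul_ite, mul_zero]

theorem reflected_mulVec_apply (ψ : Site M → ℂ) (μ : Box L M) :
    (reflected r t p L *ᵥ (ψ ∘ Box.toSite)) μ =
      ringEntry r t p L μ.toSite * ψ (ringSource μ.toSite) +
        axialEntry r t p L μ.toSite * ψ (axialSource μ.toSite) := by
  simp only [Matrix.mulVec, dotProduct, reflected_apply, Function.comp_apply, add_mul, ite_mul,
    zero_mul, Finset.sum_add_distrib]
  congr 1
  · obtain ⟨ν, hν⟩ := exists_toSite_eq_ringSource μ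
    rw [← hν, sum_ite_toSite_eq]
  · by_cases hμ : IsWall L μ.toSite
    · simp [axialEntry, hμ]
    · obtain ⟨ν, hν⟩ := exists_toSite_eq_axialSource hμ
      rw [← hν, sum_ite_toSite_eq]

theorem ringEntry_mul_star_axialEntry_add_eq_zero {μ ν : Box L M}
    (h : ringSource μ.toSite = axialSource ν.toSite) :
    ringEntry r t p L μ.toSite * star (axialEntry r t p L ν.toSite) +
      axialEntry r t p L μ.toSite * star (ringEntry r t p L ν.toSite) = 0 := by
  have hν := not_isWall_of_ringSource_eq_axialSource h
  have hμ := not_isWall_of_ringSource_eq_axialSource (ringSource_eq_axialSource_comm.mp h)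
  have hamp : (ringAmp r t μ.toSite * axialAmp r t ν.toSite +
      axialAmp r t μ.toSite * ringAmp r t ν.toSite : ℂ) = 0 :=
    mod_cast ringAmp_mul_axialAmp_add_eq_zero h
  simp only [ringEntry, axialEntry, if_neg hμ, if_neg hν, star_mul', Complex.star_def,
    Complex.conj_ofReal]
  linear_combination (p μ.toSite : ℂ) * starRingEnd ℂ (p ν.toSite) * hamp

theorem reflected_mem_unitaryGroup (h : r ^ 2 + t ^ 2 = 1) (p : Phases M) (L : ℕ) :
    reflected r t p L ∈ Matrix.unitaryGroup (Box L M) ℂ := by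
  rw [Matrix.mem_unitaryGroup_iff]
  ext μ ν
  let ψ : Site M → ℂ := fun x =>
    (if x = ringSource ν.toSite then star (ringEntry r t p L ν.toSite) else 0) +
      if x = axialSource ν.toSite then star (axialEntry r t p L ν.toSite) else 0
  have hcol : (fun x => star (reflected r t p L) x ν) = ψ ∘ Box.toSite := by
    funext x
    simp only [Matrix.star_apply, reflected_apply, star_add, apply_ite star, star_zero, ψ,
      Function.comp_apply]
  have hentry : (reflected r t p L * star (reflected r t p L)) μ ν =
      (reflected r t p L *ᵥ (ψ ∘ Box.toSite)) μ := by
    rw [← hcol]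
    rfl
  rw [hentry, reflected_mulVec_apply]
  simp only [ψ, ringSource_injective.eq_iff, axialSource_injective.eq_iff,
    toSite_injective.eq_iff, eq_comm (a := axialSource μ.toSite),
    ringSource_eq_axialSource_comm (μ := ν.toSite)]
  rcases eq_or_ne μ ν with rfl | hne
  · simpa [ringSource_ne_axialSource] using ringEntry_mul_star_add_axialEntry_mul_star h μ.toSite
  · by_cases hμν : ringSource μ.toSite = axialSource ν.toSite
    · simpa [hne, hμν] using ringEntry_mul_star_axialEntry_add_eq_zero hμν
    · simp [hne, hμν]

end Reflected

section DensityOfStates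

open MeasureTheory

section Dirac

variable {α β E : Type*} [MeasurableSpace α] [MeasurableSpace β] [NormedAddCommGroup E]

theorem integrable_multiset_sum_dirac [MeasurableSingletonClass α] (s : Multiset α) (f : α → E) :
    Integrable f (s.map Measure.dirac).sum := by
  induction s using Multiset.induction with
  | empty => simp
  | cons a s ih =>
    rw [Multiset.map_cons, Multiset.sum_cons]
    exact (integrable_dirac (by simp)).add_measure ih

theorem integral_multiset_sum_dirac [MeasurableSingletonClass α] [NormedSpace ℝ E]
    [CompleteSpace E] (s : Multiset α) (f : α → E) :
    ∫ x, f x ∂(s.map Measure.dirac).sum = (s.map f).sum := by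
  induction s using Multiset.induction with
  | empty => simp
  | cons a s ih =>
    simp only [Multiset.map_cons, Multiset.sum_cons]
    rw [integral_add_measure (integrable_dirac (by simp)) (integrable_multiset_sum_dirac s f), ih,
      integral_dirac]

theorem multiset_sum_dirac_univ (s : Multiset α) :
    (s.map Measure.dirac).sum Set.univ = Multiset.card s := by
  induction s using Multiset.induction with
  | empty => simp
  | cons a s ih => simp [ih, add_comm]

theorem map_multiset_sum_dirac (s : Multiset α) {f : α → β} (hf : Measurable f) :
    ((s.map Measure.dirac).sum).map f = ((s.map f).map Measure.dirac).sum := by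
  induction s using Multiset.induction with
  | empty => simp
  | cons a s ih =>
    simp only [Multiset.map_cons, Multiset.sum_cons]
    rw [Measure.map_add _ _ hf, ih, Measure.map_dirac' hf]

end Dirac

theorem measurableEmbedding_circle_coe : MeasurableEmbedding (fun x : Circle => (x : ℂ)) := by
  have hcont : Continuous fun x : Circle => (x : ℂ) := continuous_subtype_val
  exact (hcont.isClosedEmbedding Circle.coe_injective).measurableEmbedding

theorem card_box (L M : ℕ) : Fintype.card (Box L M) = (4 * L + 1) * (2 * M) := by
  rw [Fintype.card_prod, Fintype.card_coe, Int.card_Icc, Fintype.card_fin]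
  congr 1
  lia

variable {M : ℕ} [NeZero M] {r t : ℝ}

theorem card_roots_charpoly_reflected (r t : ℝ) (p : Phases M) (L : ℕ) :
    Multiset.card (reflected r t p L).charpoly.roots = (4 * L + 1) * (2 * M) := by
  rw [← (IsAlgClosed.splits (reflected r t p L).charpoly).natDegree_eq_card_roots,
    Matrix.charpoly_natDegree_eq_dim, card_box]

theorem norm_eq_one_of_mem_spectrum_reflected (h : r ^ 2 + t ^ 2 = 1) {p : Phases M} {L : ℕ}
    {x : ℂ} (hx : x ∈ spectrum ℂ (reflected r t p L)) : ‖x‖ = 1 := by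
  simpa using spectrum.subset_circle_of_unitary (reflected_mem_unitaryGroup h p L) hx

theorem exists_densityOfStates_eq (h : r ^ 2 + t ^ 2 = 1) (p : Phases M) (L : ℕ) :
    ∃ s : Multiset Circle, s.map (fun x : Circle => (x : ℂ)) = (reflected r t p L).charpoly.roots ∧
      densityOfStates r t p L =
        ((((4 * L + 1) * (2 * M) : ℕ) : ENNReal)⁻¹) • (s.map Measure.dirac).sum := by
  obtain ⟨s, hs⟩ : ∃ s : Multiset Circle,
      s.map (fun x : Circle => (x : ℂ)) = (reflected r t p L).charpoly.roots := by
    have hnorm : ∀ x ∈ (reflected r t p L).charpoly.roots, x ∈ Submonoid.unitSphere ℂ := by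
      intro x hx
      exact mem_sphere_zero_iff_norm.mpr (norm_eq_one_of_mem_spectrum_reflected h
        (Matrix.mem_spectrum_iff_isRoot_charpoly.mpr (Polynomial.isRoot_of_mem_roots hx)))
    exact CanLift.prf (β := Multiset (Submonoid.unitSphere ℂ)) _ hnorm
  refine ⟨s, hs, ?_⟩
  rw [densityOfStates, ← hs, ← map_multiset_sum_dirac s measurableEmbedding_circle_coe.measurable,
    measurableEmbedding_circle_coe.comap_map]

theorem integral_densityOfStates (h : r ^ 2 + t ^ 2 = 1) (p : Phases M) (L : ℕ) {E : Type*}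
    [NormedAddCommGroup E] [NormedSpace ℝ E] [CompleteSpace E] (f : ℂ → E) :
    ∫ x : Circle, f x ∂(densityOfStates r t p L) =
      ((4 * (L : ℝ) + 1) * (2 * M))⁻¹ • ((reflected r t p L).charpoly.roots.map f).sum := by
  obtain ⟨s, hs, hd⟩ := exists_densityOfStates_eq h p L
  rw [hd, integral_smul_measure, integral_multiset_sum_dirac, ← hs, Multiset.map_map,
    ENNReal.toReal_inv, ENNReal.toReal_natCast]
  norm_cast

theorem isProbabilityMeasure_densityOfStates (h : r ^ 2 + t ^ 2 = 1) (p : Phases M) (L : ℕ) :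
    IsProbabilityMeasure (densityOfStates r t p L) := by
  obtain ⟨s, hs, hd⟩ := exists_densityOfStates_eq h p L
  have hcard : Multiset.card s = (4 * L + 1) * (2 * M) := by
    rw [← card_roots_charpoly_reflected r t p L, ← hs, Multiset.card_map]
  refine ⟨?_⟩
  rw [hd, Measure.smul_apply, multiset_sum_dirac_univ, hcard, smul_eq_mul]
  exact ENNReal.inv_mul_cancel (by simp [NeZero.ne M]) (ENNReal.natCast_ne_top _)

theorem trace_cfc_reflected (h : r ^ 2 + t ^ 2 = 1) (p : Phases M) (L : ℕ) (f : ℂ → ℂ) :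
    (1 / ((4 * (L : ℂ) + 1) * (2 * (M : ℂ)))) * (cfc f (reflected r t p L)).trace =
      ∫ x : Circle, f (x : ℂ) ∂(densityOfStates r t p L) := by
  rw [trace_cfc_eq_sum_roots (isStarNormal_of_mem_unitary (reflected_mem_unitaryGroup h p L)),
    integral_densityOfStates h, Complex.real_smul]
  push_cast
  rw [one_div]

theorem integral_pow_densityOfStates (h : r ^ 2 + t ^ 2 = 1) (p : Phases M) (L n : ℕ) :
    ∫ x : Circle, (x : ℂ) ^ n ∂(densityOfStates r t p L) =
      ((4 * (L : ℝ) + 1) * (2 * M))⁻¹ • (reflected r t p L ^ n).trace := by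
  rw [integral_densityOfStates h p L fun x => x ^ n, trace_pow_eq_sum_roots]

end DensityOfStates

section WeakConvergence

open MeasureTheory Filter Topology

theorem tendsto_integral_of_topologicalClosure_span_eq_top {X ι : Type*} [TopologicalSpace X]
    [CompactSpace X] [MeasurableSpace X] [BorelSpace X] {s : Set C(X, ℂ)}
    (hs : (Submodule.span ℂ s).topologicalClosure = ⊤) {l : Filter ι} {ν : ι → Measure X}
    {ν' : Measure X} [∀ i, IsProbabilityMeasure (ν i)] [IsProbabilityMeasure ν']
    (h : ∀ g ∈ s, Tendsto (fun i => ∫ x, g x ∂ν i) l (𝓝 (∫ x, g x ∂ν'))) (f : C(X, ℂ)) :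
    Tendsto (fun i => ∫ x, f x ∂ν i) l (𝓝 (∫ x, f x ∂ν')) := by
  have hint : ∀ (m : Measure X) [IsProbabilityMeasure m] (g : C(X, ℂ)), Integrable g m :=
    fun m _ g => g.continuous.integrable_of_hasCompactSupport (.of_compactSpace g)
  have hlip : ∀ (m : Measure X) [IsProbabilityMeasure m],
      LipschitzWith 1 fun g : C(X, ℂ) => ∫ x, g x ∂m := fun m _ =>
    LipschitzWith.of_dist_le_mul fun g g' => by
      rw [dist_eq_norm, ← integral_sub (hint m g) (hint m g')]
      simpa [dist_eq_norm] using norm_integral_le_of_norm_le_const (μ := m)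
        (Eventually.of_forall fun x => (g - g').norm_coe_le_norm x)
  have hclosed : IsClosed {g : C(X, ℂ) | Tendsto (fun i => ∫ x, g x ∂ν i) l (𝓝 (∫ x, g x ∂ν'))} :=
    (LipschitzWith.uniformEquicontinuous _ 1 fun i => hlip (ν i)).equicontinuous
      |>.isClosed_setOfPred_tendsto (hlip ν').continuous
  have hspan : ∀ g ∈ Submodule.span ℂ s,
      Tendsto (fun i => ∫ x, g x ∂ν i) l (𝓝 (∫ x, g x ∂ν')) := fun g hg => by
    induction hg using Submodule.span_induction with
    | mem g hg => exact h g hg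
    | zero => simpa using tendsto_const_nhds
    | add u v _ _ hu hv =>
      simpa only [ContinuousMap.add_apply, integral_add (hint _ u) (hint _ v)] using hu.add hv
    | smul c u _ hu =>
      simpa only [ContinuousMap.smul_apply, integral_smul] using hu.const_smul c
  exact closure_minimal hspan hclosed (hs.ge (Submodule.mem_top (x := f)))

/-- The monomial `x ↦ x ^ n`, for an integer `n`, as a continuous function on the circle. -/
noncomputable def circleMonomial (n : ℤ) : C(Circle, ℂ) :=
  ⟨fun x => ((x ^ n : Circle) : ℂ), continuous_subtype_val.comp (continuous_zpow n)⟩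

theorem span_circleMonomial_topologicalClosure_eq_top :
    (Submodule.span ℂ (Set.range circleMonomial)).topologicalClosure = ⊤ := by
  let e : AddCircle (1 : ℝ) ≃ₜ Circle := AddCircle.homeomorphCircle one_ne_zero
  let T : C(AddCircle (1 : ℝ), ℂ) →L[ℂ] C(Circle, ℂ) :=
    { toFun := fun u => u.comp e.symm
      map_add' := fun _ _ => rfl
      map_smul' := fun _ _ => rfl
      cont := ContinuousMap.continuous_precomp _ }
  have hT : Function.Surjective T := fun u => ⟨u.comp e, by ext; simp [T]⟩
  have hmonomial : ∀ n, T (fourier n) = circleMonomial n := fun n => by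
    ext x
    obtain ⟨y, rfl⟩ := e.surjective x
    change fourier n (e.symm (e y)) = ((e y ^ n : Circle) : ℂ)
    rw [e.symm_apply_apply, fourier_apply, AddCircle.toCircle_zsmul,
      AddCircle.homeomorphCircle_apply]
  have hrange : T '' Set.range fourier = Set.range circleMonomial := by
    rw [← Set.range_comp]
    exact congrArg Set.range (funext hmonomial)
  rw [← hrange, ← ContinuousLinearMap.coe_coe, ← Submodule.map_span]
  exact hT.denseRange.topologicalClosure_map_submodule span_fourier_closure_eq_top

theorem integral_circleMonomial_neg (ν : Measure Circle) (n : ℤ) :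
    ∫ x, circleMonomial (-n) x ∂ν = star (∫ x, circleMonomial n x ∂ν) := by
  rw [Complex.star_def, ← integral_conj]
  simp [circleMonomial, ← Circle.coe_inv_eq_conj]

theorem exists_circle_pow_eq_neg_one {n : ℕ} (hn : n ≠ 0) : ∃ c : Circle, (c : ℂ) ^ n = -1 := by
  refine ⟨Circle.exp (Real.pi / n), ?_⟩
  have hn' : (n : ℂ) ≠ 0 := Nat.cast_ne_zero.mpr hn
  rw [Circle.coe_exp, ← Complex.exp_nat_mul, ← Complex.exp_pi_mul_I]
  congr 1
  push_cast
  field_simp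

instance : dl.IsMulLeftInvariant :=
  inferInstanceAs (Measure.haarMeasure ⊤).IsMulLeftInvariant

theorem integral_pow_dl {n : ℕ} (hn : n ≠ 0) : ∫ x : Circle, (x : ℂ) ^ n ∂dl = 0 := by
  obtain ⟨c, hc⟩ := exists_circle_pow_eq_neg_one hn
  have h := integral_mul_left_eq_self (μ := dl) (fun x : Circle => (x : ℂ) ^ n) c
  simp only [Circle.coe_mul, mul_pow, hc, integral_const_mul] at h
  linear_combination (-1 / 2 : ℂ) * h

theorem tendsto_integral_dl_of_tendsto_moments {ν : ℕ → Measure Circle}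
    [∀ L, IsProbabilityMeasure (ν L)]
    (h : ∀ n : ℕ, n ≠ 0 → Tendsto (fun L => ∫ x : Circle, (x : ℂ) ^ n ∂ν L) atTop (𝓝 0))
    (f : C(Circle, ℂ)) :
    Tendsto (fun L => ∫ x, f x ∂ν L) atTop (𝓝 (∫ x, f x ∂dl)) := by
  refine tendsto_integral_of_topologicalClosure_span_eq_top
    span_circleMonomial_topologicalClosure_eq_top ?_ f
  have hnat : ∀ n : ℕ, Tendsto (fun L => ∫ x, circleMonomial n x ∂ν L) atTop
      (𝓝 (∫ x, circleMonomial n x ∂dl)) := by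
    intro n
    rcases eq_or_ne n 0 with rfl | hn
    · simp [circleMonomial]
    · simpa [circleMonomial, integral_pow_dl hn] using h n hn
  rintro _ ⟨n, rfl⟩
  rcases Int.eq_nat_or_neg n with ⟨k, rfl | rfl⟩
  · exact hnat k
  · simp only [integral_circleMonomial_neg]
    exact (hnat k).star

end WeakConvergence

section NetworkOperator

variable {M : ℕ}

theorem abs_axialSource_fst_sub_le_one (μ : Site M) : |(axialSource μ).1 - μ.1| ≤ 1 := by
  simp only [axialSource]
  split_ifs <;> simp

/-- Translation of the cylinder by `2s` columns, which is compatible with the scattering rule. -/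
def translate (s : ℤ) (μ : Site M) : Site M := (μ.1 + 2 * s, μ.2)

theorem translate_injective (s : ℤ) : Function.Injective (translate (M := M) s) := by
  rintro ⟨n, k⟩ ⟨n', k'⟩ h
  simpa [translate] using h

variable [NeZero M] {r t : ℝ}

/-- The network operator `U(p)`, acting on arbitrary functions on the infinite cylinder. -/
noncomputable def network (r t : ℝ) (p : Phases M) : Module.End ℂ (Site M → ℂ) where
  toFun ψ μ := p μ * (ringAmp r t μ * ψ (ringSource μ) + axialAmp r t μ * ψ (axialSource μ))
  map_add' ψ φ := by
    funext μ
    simp only [Pi.add_apply]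
    ring
  map_smul' c ψ := by
    funext μ
    simp only [Pi.smul_apply, smul_eq_mul, RingHom.id_apply]
    ring

theorem network_apply (p : Phases M) (ψ : Site M → ℂ) (μ : Site M) :
    network r t p ψ μ =
      p μ * (ringAmp r t μ * ψ (ringSource μ) + axialAmp r t μ * ψ (axialSource μ)) :=
  rfl

theorem network_pow_succ_apply (p : Phases M) (n : ℕ) (ψ : Site M → ℂ) (μ : Site M) :
    (network r t p ^ (n + 1)) ψ μ =
      p μ * (ringAmp r t μ * (network r t p ^ n) ψ (ringSource μ) +
        axialAmp r t μ * (network r t p ^ n) ψ (axialSource μ)) := by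
  rw [pow_succ', Module.End.mul_apply, network_apply]

theorem network_smul (c : Circle) (p : Phases M) :
    network r t (c • p) = (c : ℂ) • network r t p := by
  ext ψ μ
  simp only [LinearMap.smul_apply, Pi.smul_apply, network_apply, smul_eq_mul, Circle.coe_mul,
    mul_assoc]

theorem dependsOn_network_pow_apply (n : ℕ) (ψ : Site M → ℂ) (μ : Site M) :
    DependsOn (fun p => (network r t p ^ n) ψ μ) {ν | |ν.1 - μ.1| ≤ n} := by
  intro p p' hp
  induction n generalizing μ with
  | zero => rfl
  | succ n ih =>
    have hring := ih (ringSource μ) fun ν hν =>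
      hp ν <| (Set.mem_ofPred.mp hν).trans (by push_cast; exact (lt_add_one _).le)
    have haxial := ih (axialSource μ) fun ν hν =>
      hp ν <| (abs_sub_le _ (axialSource μ).1 _).trans <|
        (add_le_add hν (abs_axialSource_fst_sub_le_one μ)).trans_eq (by push_cast; rfl)
    simp only [network_pow_succ_apply, hring, haxial, hp μ (by simpa using Nat.cast_nonneg (n + 1))]

theorem measurable_network_pow_apply (n : ℕ) (ψ : Site M → ℂ) (μ : Site M) :
    Measurable fun p => (network r t p ^ n) ψ μ := by
  induction n generalizing μ with
  | zero => exact measurable_const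
  | succ n ih =>
    simp only [network_pow_succ_apply]
    exact (measurableEmbedding_circle_coe.measurable.comp (measurable_pi_apply μ)).mul
      (((ih _).const_mul _).add ((ih _).const_mul _))

theorem norm_network_pow_apply_le (h : r ^ 2 + t ^ 2 = 1) (p : Phases M) {ψ : Site M → ℂ} {K : ℝ}
    (hψ : ∀ μ, ‖ψ μ‖ ≤ K) (n : ℕ) (μ : Site M) : ‖(network r t p ^ n) ψ μ‖ ≤ 2 ^ n * K := by
  induction n generalizing μ with
  | zero => simpa using hψ μ
  | succ n ih =>
    have hsq := ringAmp_sq_add_axialAmp_sq h μ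
    have hring : |ringAmp r t μ| ≤ 1 := sq_le_one_iff_abs_le_one _ |>.mp (by nlinarith)
    have haxial : |axialAmp r t μ| ≤ 1 := sq_le_one_iff_abs_le_one _ |>.mp (by nlinarith)
    calc ‖(network r t p ^ (n + 1)) ψ μ‖
        ≤ |ringAmp r t μ| * ‖(network r t p ^ n) ψ (ringSource μ)‖ +
            |axialAmp r t μ| * ‖(network r t p ^ n) ψ (axialSource μ)‖ := by
          rw [network_pow_succ_apply, norm_mul, Circle.norm_coe, one_mul]
          exact (norm_add_le _ _).trans_eq (by simp)
      _ ≤ 1 * (2 ^ n * K) + 1 * (2 ^ n * K) := by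
          gcongr <;> exact ih _
      _ = 2 ^ (n + 1) * K := by ring

theorem network_pow_comp_translate (p : Phases M) (s : ℤ) (n : ℕ) (ψ : Site M → ℂ) :
    (network r t (p ∘ translate s) ^ n) (ψ ∘ translate s) =
      (network r t p ^ n) ψ ∘ translate s := by
  induction n with
  | zero => rfl
  | succ n ih =>
    funext μ
    have heven : Even (translate s μ).1 ↔ Even μ.1 := by simp [translate, Int.even_add]
    have hring : ringSource (translate s μ) = translate s (ringSource μ) := by
      simp only [ringSource, heven]
      rfl
    have haxial : axialSource (translate s μ) = translate s (axialSource μ) := by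
      by_cases hk : Even (μ.2 : ℕ) <;> simp only [axialSource, translate, hk, if_true, if_false] <;>
        exact Prod.ext (by ring) rfl
    have hringAmp : ringAmp r t (translate s μ) = ringAmp r t μ := by
      simp only [ringAmp, heven]
      rfl
    have haxialAmp : axialAmp r t (translate s μ) = axialAmp r t μ := by
      simp only [axialAmp, heven]
      rfl
    simp only [network_pow_succ_apply, Function.comp_apply, ih, hring, haxial, hringAmp,
      haxialAmp]

theorem reflected_pow_mulVec_apply {p : Phases M} {L n : ℕ} {μ : Box L M} (ψ : Site M → ℂ)
    (hμ : |μ.toSite.1| + n ≤ 2 * (L : ℤ)) :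
    (reflected r t p L ^ n *ᵥ (ψ ∘ Box.toSite)) μ = (network r t p ^ n) ψ μ.toSite := by
  induction n generalizing μ with
  | zero => rw [pow_zero, pow_zero, Matrix.one_mulVec]; rfl
  | succ n ih =>
    have hwall : ¬IsWall L μ.toSite := by
      rw [isWall_toSite_iff]
      grind
    obtain ⟨Φ, hΦ⟩ : ∃ Φ : Site M → ℂ,
        Φ ∘ Box.toSite = reflected r t p L ^ n *ᵥ (ψ ∘ Box.toSite) :=
      ⟨_, Function.extend_comp toSite_injective _ 0⟩
    have hval {κ : Site M} (hκ : ∃ ν : Box L M, ν.toSite = κ) (hcol : |κ.1| + n ≤ 2 * (L : ℤ)) :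
        Φ κ = (network r t p ^ n) ψ κ := by
      obtain ⟨ν, rfl⟩ := hκ
      rw [← ih hcol, ← hΦ, Function.comp_apply]
    have hring := hval (exists_toSite_eq_ringSource μ) (by rw [ringSource]; lia)
    have haxial := hval (exists_toSite_eq_axialSource hwall) (by
      have := abs_sub_abs_le_abs_sub (axialSource μ.toSite).1 μ.toSite.1
      have := abs_axialSource_fst_sub_le_one μ.toSite
      lia)
    rw [pow_succ', ← Matrix.mulVec_mulVec, ← hΦ, reflected_mulVec_apply, network_pow_succ_apply,
      hring, haxial, ringEntry, axialEntry, if_neg hwall, if_neg hwall]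
    ring

end NetworkOperator

section ColumnTrace

variable {M : ℕ} [NeZero M] {r t : ℝ}

/-- The contribution of the column `m` to the trace of the `n`-th power of `U(p)`. -/
noncomputable def columnTrace (r t : ℝ) (n : ℕ) (m : ℤ) (p : Phases M) : ℂ :=
  ∑ k : Fin (2 * M), (network r t p ^ n) (Pi.single (m, k) 1) (m, k)

theorem dependsOn_columnTrace (n : ℕ) (m : ℤ) :
    DependsOn (columnTrace (M := M) r t n m) {ν | |ν.1 - m| ≤ n} := fun _ _ hp =>
  Finset.sum_congr rfl fun _ _ => dependsOn_network_pow_apply _ _ _ hp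

theorem measurable_columnTrace (n : ℕ) (m : ℤ) :
    Measurable (columnTrace (M := M) r t n m) :=
  Finset.measurable_fun_sum _ fun _ _ => measurable_network_pow_apply _ _ _

theorem columnTrace_smul (n : ℕ) (m : ℤ) (c : Circle) (p : Phases M) :
    columnTrace r t n m (c • p) = (c : ℂ) ^ n * columnTrace r t n m p := by
  simp only [columnTrace, network_smul, smul_pow, LinearMap.smul_apply, Pi.smul_apply,
    smul_eq_mul, Finset.mul_sum]

theorem columnTrace_add_two_mul (n : ℕ) (m s : ℤ) (p : Phases M) :
    columnTrace r t n (m + 2 * s) p = columnTrace r t n m (p ∘ translate s) := by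
  refine Finset.sum_congr rfl fun k _ => ?_
  have hsingle : (Pi.single (m, k) 1 : Site M → ℂ) =
      Pi.single (m + 2 * s, k) 1 ∘ translate s := by
    funext μ
    simp only [Function.comp_apply, Pi.single_apply]
    exact if_congr (translate_injective s).eq_iff.symm rfl rfl
  rw [hsingle, network_pow_comp_translate]
  rfl

theorem norm_network_pow_single_le (h : r ^ 2 + t ^ 2 = 1) (p : Phases M) (n : ℕ)
    (μ ν : Site M) : ‖(network r t p ^ n) (Pi.single ν 1) μ‖ ≤ 2 ^ n := by
  refine (norm_network_pow_apply_le h p (K := 1) (fun κ => ?_) n μ).trans_eq (mul_one _)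
  rw [Pi.single_apply]
  split_ifs <;> simp

theorem norm_columnTrace_le (h : r ^ 2 + t ^ 2 = 1) (n : ℕ) (m : ℤ) (p : Phases M) :
    ‖columnTrace r t n m p‖ ≤ 2 * M * 2 ^ n :=
  (norm_sum_le_of_le _ fun _ _ => norm_network_pow_single_le h p n _ _).trans_eq (by simp)

theorem reflected_pow_apply {p : Phases M} {L n : ℕ} {μ : Box L M}
    (hμ : |μ.toSite.1| + n ≤ 2 * (L : ℤ)) (ν : Box L M) :
    (reflected r t p L ^ n) μ ν = (network r t p ^ n) (Pi.single ν.toSite 1) μ.toSite := by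
  have hsingle : (Pi.single ν 1 : Box L M → ℂ) = Pi.single ν.toSite 1 ∘ Box.toSite := by
    funext κ
    simp only [Function.comp_apply, Pi.single_apply, toSite_injective.eq_iff]
  rw [← reflected_pow_mulVec_apply _ hμ, ← hsingle, Matrix.mulVec_single_one]
  rfl

theorem norm_reflected_pow_sub_network_pow_le (h : r ^ 2 + t ^ 2 = 1) (p : Phases M) {L : ℕ}
    (n : ℕ) (μ ν : Box L M) :
    ‖(reflected r t p L ^ n) μ ν - (network r t p ^ n) (Pi.single ν.toSite 1) μ.toSite‖ ≤
      if 2 * (L : ℤ) < |μ.toSite.1| + n then 1 + 2 ^ n else 0 := by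
  split_ifs with hμ
  · exact norm_sub_le_of_le
      (entry_norm_bound_of_unitary (pow_mem (reflected_mem_unitaryGroup h p L) n) μ ν)
      (norm_network_pow_single_le h p n _ _)
  · rw [reflected_pow_apply (not_lt.mp hμ), sub_self, norm_zero]

theorem card_filter_near_ends_le (N n : ℕ) :
    ((Finset.Icc (-(N : ℤ)) N).filter fun m => (N : ℤ) < |m| + n).card ≤ 2 * n := by
  have hsub : ((Finset.Icc (-(N : ℤ)) N).filter fun m => (N : ℤ) < |m| + n) ⊆
      Finset.Ioc ((N : ℤ) - n) N ∪ Finset.Ico (-(N : ℤ)) (-N + n) := by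
    intro m hm
    simp only [Finset.mem_filter, Finset.mem_Icc] at hm
    simp only [Finset.mem_union, Finset.mem_Ioc, Finset.mem_Ico]
    rcases abs_cases m with h | h <;> lia
  refine (Finset.card_le_card hsub).trans ((Finset.card_union_le _ _).trans ?_)
  rw [Int.card_Ioc, Int.card_Ico]
  lia

theorem norm_trace_reflected_pow_sub_sum_columnTrace_le (h : r ^ 2 + t ^ 2 = 1) (p : Phases M)
    (n L : ℕ) :
    ‖(reflected r t p L ^ n).trace -
      ∑ m ∈ Finset.Icc (-(2 * (L : ℤ))) (2 * L), columnTrace r t n m p‖ ≤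
      2 * n * (2 * M * (1 + 2 ^ n)) := by
  let I := Finset.Icc (-(2 * (L : ℤ))) (2 * L)
  have hdiff : (reflected r t p L ^ n).trace - ∑ m ∈ I, columnTrace r t n m p =
      ∑ μ : Box L M, ((reflected r t p L ^ n) μ μ -
        (network r t p ^ n) (Pi.single μ.toSite 1) μ.toSite) := by
    rw [Finset.sum_sub_distrib, ← Finset.sum_coe_sort I, Fintype.sum_prod_type
      (f := fun μ : Box L M => (network r t p ^ n) (Pi.single μ.toSite 1) μ.toSite)]
    rfl
  have hcard : ((I.filter fun m => 2 * (L : ℤ) < |m| + n).card : ℝ) ≤ 2 * n := by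
    have := card_filter_near_ends_le (2 * L) n
    push_cast at this
    exact mod_cast this
  let bound : ℤ → ℝ := fun m => if 2 * (L : ℤ) < |m| + n then 1 + 2 ^ n else 0
  calc ‖(reflected r t p L ^ n).trace - ∑ m ∈ I, columnTrace r t n m p‖
      ≤ ∑ μ : Box L M, bound μ.1 := by
        rw [hdiff]
        exact norm_sum_le_of_le _ fun μ _ => norm_reflected_pow_sub_network_pow_le h p n μ μ
    _ = 2 * M * ∑ m ∈ I, bound m := by
        rw [← Finset.sum_coe_sort I, Fintype.sum_prod_type, Finset.mul_sum]
        simp [I]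
    _ = (I.filter fun m => 2 * (L : ℤ) < |m| + n).card * (2 * M * (1 + 2 ^ n)) := by
        rw [← Finset.sum_filter, Finset.sum_const, nsmul_eq_mul]
        ring
    _ ≤ 2 * n * (2 * M * (1 + 2 ^ n)) := by gcongr

end ColumnTrace

section StrongLaw

open Filter MeasureTheory ProbabilityTheory Topology

theorem sum_range_eq_sum_residues {E : Type*} [AddCommMonoid E] (u : ℕ → E) {K : ℕ} (hK : K ≠ 0)
    (N : ℕ) : ∑ i ∈ Finset.range N, u i =
      ∑ j ∈ Finset.range K, ∑ a ∈ Finset.range ((N + (K - 1 - j)) / K), u (j + K * a) := by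
  have hlt (j a : ℕ) (hj : j < K) : a < (N + (K - 1 - j)) / K ↔ j + K * a < N := by
    rw [Nat.lt_div_iff_mul_lt (Nat.pos_of_ne_zero hK), mul_comm]
    lia
  rw [Finset.sum_sigma']
  refine (Finset.sum_bij' (fun x _ => x.1 + K * x.2) (fun i _ => ⟨i % K, i / K⟩) ?_ ?_ ?_ ?_
    ?_).symm
  · rintro ⟨j, a⟩ hx
    simp only [Finset.mem_sigma, Finset.mem_range] at hx ⊢
    exact (hlt j a hx.1).mp hx.2
  · intro i hi
    have hmod := Nat.mod_lt i (Nat.pos_of_ne_zero hK)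
    simp only [Finset.mem_sigma, Finset.mem_range] at hi ⊢
    exact ⟨hmod, (hlt _ _ hmod).mpr (by rwa [Nat.mod_add_div])⟩
  · rintro ⟨j, a⟩ hx
    simp only [Finset.mem_sigma, Finset.mem_range] at hx
    rw [Nat.add_mul_mod_self_left, Nat.mod_eq_of_lt hx.1,
      Nat.add_mul_div_left _ _ (Nat.pos_of_ne_zero hK), Nat.div_eq_of_lt hx.1, zero_add]
  · exact fun i _ => Nat.mod_add_div i K
  · exact fun _ _ => rfl

theorem tendsto_average_zero_of_residues {E : Type*} [NormedAddCommGroup E] [NormedSpace ℝ E]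
    {u : ℕ → E} {K : ℕ} (hK : K ≠ 0)
    (h : ∀ j < K,
      Tendsto (fun N : ℕ => (N : ℝ)⁻¹ • ∑ a ∈ Finset.range N, u (j + K * a)) atTop (𝓝 0)) :
    Tendsto (fun N : ℕ => (N : ℝ)⁻¹ • ∑ i ∈ Finset.range N, u i) atTop (𝓝 0) := by
  simp only [sum_range_eq_sum_residues u hK, Finset.smul_sum (r := (_ : ℝ)⁻¹)
    (s := Finset.range K)]
  rw [← Finset.sum_const_zero (s := Finset.range K)]
  refine tendsto_finsetSum _ fun j hj => ?_
  have hcount : Tendsto (fun N => (N + (K - 1 - j)) / K) atTop atTop :=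
    (Nat.tendsto_div_const_atTop hK).comp (tendsto_add_atTop_nat _)
  refine squeeze_zero_norm (fun N => ?_)
    (tendsto_zero_iff_norm_tendsto_zero.mp ((h j (Finset.mem_range.mp hj)).comp hcount))
  set q := (N + (K - 1 - j)) / K with hq
  rcases Nat.eq_zero_or_pos q with hq0 | hq0
  · simp [hq0]
  have hqN : q ≤ N := by
    rcases Nat.eq_zero_or_pos N with rfl | hN
    · exact (Nat.div_eq_of_lt (by lia)).le
    · refine Nat.div_le_of_le_mul ?_
      obtain ⟨k, rfl⟩ := Nat.exists_eq_succ_of_ne_zero hK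
      obtain ⟨n, rfl⟩ := Nat.exists_eq_succ_of_ne_zero hN.ne'
      simp only [Nat.succ_eq_add_one]
      nlinarith [Nat.zero_le (k * n), show k + 1 - 1 - j ≤ k by lia]
  rw [Function.comp_apply, norm_smul, norm_smul, norm_inv, norm_inv, Real.norm_natCast,
    Real.norm_natCast]
  gcongr

theorem ae_tendsto_average_zero_of_residues {Ω E : Type*} {mΩ : MeasurableSpace Ω}
    {P : Measure Ω} [NormedAddCommGroup E] [NormedSpace ℝ E] [CompleteSpace E] [MeasurableSpace E]
    [BorelSpace E] {X : ℕ → Ω → E} {K : ℕ} (hK : K ≠ 0) (hint : ∀ i, Integrable (X i) P)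
    (hzero : ∀ i, ∫ ω, X i ω ∂P = 0)
    (hindep : ∀ i j, i ≠ j → i ≡ j [MOD K] → IndepFun (X i) (X j) P)
    (hident : ∀ i j, i ≡ j [MOD K] → IdentDistrib (X j) (X i) P P) :
    ∀ᵐ ω ∂P, Tendsto (fun N : ℕ => (N : ℝ)⁻¹ • ∑ i ∈ Finset.range N, X i ω) atTop (𝓝 0) := by
  have hmod (j a b : ℕ) : j + K * a ≡ j + K * b [MOD K] := by simp [Nat.ModEq]
  have hres : ∀ᵐ ω ∂P, ∀ j, Tendsto
      (fun N : ℕ => (N : ℝ)⁻¹ • ∑ a ∈ Finset.range N, X (j + K * a) ω) atTop (𝓝 0) := by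
    refine ae_all_iff.mpr fun j => ?_
    have hslln := strong_law_ae (fun a => X (j + K * a)) (hint _)
      (fun a b hab => hindep _ _ (by simpa [hK] using hab) (hmod j a b))
      (fun a => hident _ _ (hmod j 0 a))
    rwa [hzero] at hslln
  filter_upwards [hres] with ω hω
  exact tendsto_average_zero_of_residues hK fun j _ => hω j

theorem eq_comp_updateFinset_of_dependsOn {ι β : Type*} [DecidableEq ι] {Ω : ι → Type*}
    {X : (∀ i, Ω i) → β} {S : Finset ι} (hX : DependsOn X S) (x₀ : ∀ i, Ω i) :
    X = (X ∘ Function.updateFinset x₀ S) ∘ fun x (i : S) => x i := by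
  funext x
  refine hX fun i hi => ?_
  rw [Function.updateFinset, dif_pos (Finset.mem_coe.mp hi)]

theorem indepFun_infinitePi_of_dependsOn {ι : Type*} {Ω : ι → Type*} [∀ i, MeasurableSpace (Ω i)]
    (P : ∀ i, Measure (Ω i)) [∀ i, IsProbabilityMeasure (P i)] {β γ : Type*} [MeasurableSpace β]
    [MeasurableSpace γ] {S T : Finset ι} (hST : Disjoint S T) {X : (∀ i, Ω i) → β}
    {Y : (∀ i, Ω i) → γ} (hX : Measurable X) (hXS : DependsOn X S) (hY : Measurable Y)
    (hYT : DependsOn Y T) : IndepFun X Y (Measure.infinitePi P) := by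
  classical
  obtain ⟨x₀⟩ : Nonempty (∀ i, Ω i) := ⟨fun i => (nonempty_of_isProbabilityMeasure (P i)).some⟩
  have hindep := (iIndepFun_infinitePi (P := P) (X := fun _ x => x)
    fun _ => measurable_id).indepFun_finset S T hST fun i => measurable_pi_apply i
  rw [eq_comp_updateFinset_of_dependsOn hXS x₀, eq_comp_updateFinset_of_dependsOn hYT x₀]
  exact hindep.comp (hX.comp measurable_updateFinset) (hY.comp measurable_updateFinset)

/-- The enumeration `0, -1, 1, -2, 2, …` of the integers. -/
def zigzag (i : ℕ) : ℤ :=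
  if Even i then i / 2 else -((i + 1) / 2)

theorem sum_range_zigzag {E : Type*} [AddCommMonoid E] (f : ℤ → E) (N : ℕ) :
    ∑ i ∈ Finset.range (2 * N + 1), f (zigzag i) = ∑ m ∈ Finset.Icc (-(N : ℤ)) N, f m := by
  refine Finset.sum_bij' (fun i _ => zigzag i)
    (fun m _ => if 0 ≤ m then (2 * m).toNat else (-2 * m - 1).toNat) ?_ ?_ ?_ ?_
    fun _ _ => rfl <;>
  · intro i hi
    simp only [zigzag, Finset.mem_range, Finset.mem_Icc] at hi ⊢
    grind

theorem exists_zigzag_eq_add {i j k : ℕ} (h : i ≡ j [MOD 4 * k]) :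
    ∃ s : ℤ, zigzag j = zigzag i + 2 * (k * s) ∧ (i ≠ j → s ≠ 0) := by
  obtain ⟨s, hs⟩ := (Nat.modEq_iff_dvd).mp h
  push_cast at hs
  have hne : i ≠ j → s ≠ 0 := by
    rintro hij rfl
    lia
  by_cases hi : Even i
  · refine ⟨s, ?_, hne⟩
    simp only [zigzag]
    grind
  · refine ⟨-s, ?_, by simpa using hne⟩
    simp only [zigzag]
    grind

end StrongLaw

section Flatness

open Filter MeasureTheory ProbabilityTheory Topology

variable {M : ℕ}

instance : IsProbabilityMeasure (phaseLaw M) := by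
  unfold phaseLaw
  infer_instance

theorem measurePreserving_const_smul_phaseLaw (c : Circle) :
    MeasurePreserving (c • · : Phases M → Phases M) (phaseLaw M) (phaseLaw M) := by
  refine ⟨measurable_const_smul c, ?_⟩
  refine (Measure.infinitePi_map_pi (fun _ => dl) (f := fun _ x => c * x)
    fun _ => measurable_const_mul c).trans ?_
  simp only [map_mul_left_eq_self]
  rfl

theorem measurePreserving_comp_translate_phaseLaw (s : ℤ) :
    MeasurePreserving (fun p : Phases M => p ∘ translate s) (phaseLaw M) (phaseLaw M) :=
  ⟨measurable_pi_lambda _ fun _ => measurable_pi_apply _,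
    Measure.map_infinitePi_infinitePi_of_inj (P := fun _ => dl) (translate_injective s)⟩

variable [NeZero M] {r t : ℝ}

theorem integrable_columnTrace (h : r ^ 2 + t ^ 2 = 1) (n : ℕ) (m : ℤ) :
    Integrable (columnTrace (M := M) r t n m) (phaseLaw M) :=
  .of_bound (measurable_columnTrace n m).aestronglyMeasurable _
    (.of_forall fun p => norm_columnTrace_le h n m p)

theorem integral_columnTrace {n : ℕ} (hn : n ≠ 0) (m : ℤ) :
    ∫ p, columnTrace (M := M) r t n m p ∂phaseLaw M = 0 := by
  obtain ⟨c, hc⟩ := exists_circle_pow_eq_neg_one hn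
  have h := integral_map (measurePreserving_const_smul_phaseLaw (M := M) c).aemeasurable
    (measurable_columnTrace (r := r) (t := t) n m).aestronglyMeasurable
  rw [(measurePreserving_const_smul_phaseLaw c).map_eq] at h
  simp only [columnTrace_smul, hc, neg_one_mul, integral_neg] at h
  exact self_eq_neg.mp h

theorem identDistrib_columnTrace (n : ℕ) (m s : ℤ) :
    IdentDistrib (columnTrace (M := M) r t n (m + 2 * s)) (columnTrace r t n m)
      (phaseLaw M) (phaseLaw M) := by
  have hshift : columnTrace (M := M) r t n (m + 2 * s) =
      columnTrace r t n m ∘ fun p => p ∘ translate s :=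
    funext (columnTrace_add_two_mul n m s)
  refine ⟨(measurable_columnTrace n _).aemeasurable, (measurable_columnTrace n m).aemeasurable, ?_⟩
  rw [hshift, ← Measure.map_map (measurable_columnTrace n m)
    (measurePreserving_comp_translate_phaseLaw s).measurable,
    (measurePreserving_comp_translate_phaseLaw s).map_eq]

theorem indepFun_columnTrace (n : ℕ) {m m' : ℤ} (h : 2 * (n : ℤ) < |m - m'|) :
    IndepFun (columnTrace (M := M) r t n m) (columnTrace r t n m') (phaseLaw M) := by
  let strip (m : ℤ) : Finset (Site M) := Finset.Icc (m - n) (m + n) ×ˢ Finset.univ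
  have hstrip (m : ℤ) : DependsOn (columnTrace (M := M) r t n m) (strip m) :=
    (dependsOn_columnTrace n m).mono fun ν hν => by
      have := abs_le.mp (Set.mem_ofPred.mp hν)
      simp only [strip, Finset.coe_product, Finset.coe_Icc, Finset.coe_univ, Set.mem_prod,
        Set.mem_Icc, Set.mem_univ, and_true]
      lia
  refine indepFun_infinitePi_of_dependsOn (fun _ => dl) (S := strip m) (T := strip m') ?_
    (measurable_columnTrace n m) (hstrip m) (measurable_columnTrace n m') (hstrip m')
  refine Finset.disjoint_left.mpr fun ν hν hν' => ?_
  simp only [strip, Finset.mem_product, Finset.mem_Icc, Finset.mem_univ, and_true] at hν hν'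
  rcases abs_cases (m - m') with h' | h' <;> lia

theorem ae_tendsto_average_columnTrace (h : r ^ 2 + t ^ 2 = 1) {n : ℕ} (hn : n ≠ 0) :
    ∀ᵐ p ∂phaseLaw M, Tendsto
      (fun N : ℕ => (N : ℝ)⁻¹ • ∑ i ∈ Finset.range N, columnTrace r t n (zigzag i) p)
      atTop (𝓝 0) := by
  refine ae_tendsto_average_zero_of_residues (K := 4 * (n + 1)) (by lia)
    (fun i => integrable_columnTrace h n _) (fun i => integral_columnTrace hn _) ?_ ?_
  · intro i j hij hmod
    obtain ⟨s, hs, hs0⟩ := exists_zigzag_eq_add hmod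
    refine indepFun_columnTrace n ?_
    have hs1 : 1 ≤ |s| := Int.one_le_abs (hs0 hij)
    rw [hs, sub_add_cancel_left, abs_neg, abs_mul, abs_mul, abs_two, Nat.abs_cast]
    push_cast
    nlinarith
  · intro i j hmod
    obtain ⟨s, hs, -⟩ := exists_zigzag_eq_add hmod
    rw [hs]
    exact identDistrib_columnTrace n _ _

theorem norm_integral_pow_densityOfStates_le (h : r ^ 2 + t ^ 2 = 1) (p : Phases M) (L n : ℕ) :
    ‖∫ x : Circle, (x : ℂ) ^ n ∂densityOfStates r t p L‖ ≤
      ‖((2 * (2 * L) + 1 : ℕ) : ℝ)⁻¹ •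
          ∑ i ∈ Finset.range (2 * (2 * L) + 1), columnTrace r t n (zigzag i) p‖ +
        2 * n * (2 * M * (1 + 2 ^ n)) * ((2 * (2 * L) + 1 : ℕ) : ℝ)⁻¹ := by
  have htrace := norm_trace_reflected_pow_sub_sum_columnTrace_le h p n L
  have hsum := sum_range_zigzag (fun m => columnTrace r t n m p) (2 * L)
  push_cast at hsum
  rw [← hsum] at htrace
  have hM : (1 : ℝ) ≤ 2 * M := by
    have : (1 : ℝ) ≤ M := mod_cast NeZero.one_le
    linarith
  have hnorm : ‖((4 * (L : ℝ) + 1) * (2 * M))⁻¹‖ ≤ ((2 * (2 * L) + 1 : ℕ) : ℝ)⁻¹ := by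
    rw [norm_inv, Real.norm_of_nonneg (by positivity)]
    refine inv_anti₀ (by positivity) ?_
    push_cast
    nlinarith [(Nat.cast_nonneg L : (0 : ℝ) ≤ L)]
  rw [integral_pow_densityOfStates h, norm_smul, norm_smul, norm_inv (Nat.cast _ : ℝ),
    Real.norm_natCast, mul_comm (2 * (n : ℝ) * _), ← mul_add]
  gcongr
  exact (norm_le_norm_add_norm_sub' _ _).trans (by gcongr)

theorem ae_tendsto_integral_pow_densityOfStates (h : r ^ 2 + t ^ 2 = 1) {n : ℕ} (hn : n ≠ 0) :
    ∀ᵐ p ∂phaseLaw M, Tendsto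
      (fun L => ∫ x : Circle, (x : ℂ) ^ n ∂densityOfStates r t p L) atTop (𝓝 0) := by
  filter_upwards [ae_tendsto_average_columnTrace h hn] with p hp
  have hcols : Tendsto (fun L : ℕ => 2 * (2 * L) + 1) atTop atTop :=
    tendsto_atTop_mono (fun L => by simp only [id]; lia) tendsto_id
  have hbound := (hp.comp hcols).norm.add
    ((tendsto_inv_atTop_nhds_zero_nat.comp hcols).const_mul (2 * n * (2 * M * (1 + 2 ^ n) : ℝ)))
  rw [norm_zero, mul_zero, add_zero] at hbound
  exact squeeze_zero_norm (fun L => norm_integral_pow_densityOfStates_le h p L n) hbound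

theorem ae_tendsto_integral_densityOfStates (h : r ^ 2 + t ^ 2 = 1) :
    ∀ᵐ p ∂phaseLaw M, ∀ f : C(Circle, ℂ),
      Tendsto (fun L => ∫ x, f x ∂densityOfStates r t p L) atTop (𝓝 (∫ x, f x ∂dl)) := by
  have hmoments : ∀ᵐ p ∂phaseLaw M, ∀ n : ℕ, n ≠ 0 → Tendsto
      (fun L => ∫ x : Circle, (x : ℂ) ^ n ∂densityOfStates r t p L) atTop (𝓝 0) :=
    ae_all_iff.mpr fun n => eventually_imp_distrib_left.mpr fun hn =>
      ae_tendsto_integral_pow_densityOfStates h hn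
  filter_upwards [hmoments] with p hp f
  have := isProbabilityMeasure_densityOfStates h p
  exact tendsto_integral_dl_of_tendsto_moments hp f

end Flatness

section Parity

theorem det_eq_prod_diag_of_pred {ι R : Type*} [Fintype ι] [DecidableEq ι] [CommRing R]
    {A : Matrix ι ι R} (p : ι → Prop)
    (h : ∀ i j, i ≠ j → (p i → p j) → A i j = 0) : A.det = ∏ i, A i i := by
  classical
  have hdiag (q : ι → Prop) [DecidablePred q] (hq : ∀ i j, q i → q j → p i → p j) :
      A.toSquareBlockProp q = Matrix.diagonal fun i : {i // q i} => A i i := by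
    ext i j
    rcases eq_or_ne i j with rfl | hij
    · rw [Matrix.diagonal_apply_eq, Matrix.toSquareBlockProp_def, Matrix.of_apply]
    · rw [Matrix.diagonal_apply_ne _ hij, Matrix.toSquareBlockProp_def, Matrix.of_apply]
      exact h _ _ (Subtype.coe_injective.ne hij) (hq _ _ i.2 j.2)
  rw [Matrix.twoBlockTriangular_det A p fun i hi j hj => h i j (by grind) fun _ => hj,
    hdiag p fun _ _ _ hj _ => hj, hdiag (¬p ·) fun _ _ hi _ hi' => absurd hi' hi,
    Matrix.det_diagonal, Matrix.det_diagonal]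
  exact Fintype.prod_subtype_mul_prod_subtype p fun i => A i i

theorem prod_ite_even_val {R : Type*} [CommMonoid R] (x y : R) (N : ℕ) :
    ∏ k : Fin (2 * N), (if Even (k : ℕ) then x else y) = (x * y) ^ N := by
  rw [Fin.prod_univ_eq_prod_range fun k => if Even k then x else y]
  induction N with
  | zero => simp
  | succ N ih => simp [mul_add_one, Finset.prod_range_succ, ih, pow_succ, mul_assoc, parity_simps]

theorem card_subtype_not_even_val (N : ℕ) :
    Fintype.card {k : Fin (2 * N) // ¬Even (k : ℕ)} = N := by
  have h := prod_ite_even_val 1 2 N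
  rw [Finset.prod_ite, Finset.prod_const_one, Finset.prod_const, one_mul, one_mul] at h
  rw [Fintype.card_subtype]
  exact Nat.pow_right_injective le_rfl h

end Parity

section ColumnTransfer

variable {M : ℕ} {r t : ℝ}

theorem axialAmp_ne_zero (hrt : r * t ≠ 0) (μ : Site M) : axialAmp r t μ ≠ 0 := by
  grind [axialAmp]

theorem axialAmp_mul_axialAmp_sq (h : r ^ 2 + t ^ 2 = 1) (n : ℤ) {k k' : Fin (2 * M)}
    (hk : Even (k : ℕ)) (hk' : ¬Even (k' : ℕ)) :
    axialAmp r t (n, k') * axialAmp r t (n + 1, k) ^ 2 =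
      axialAmp r t (n, k') +
        axialAmp r t (n + 1, k) * ringAmp r t (n + 1, k) * ringAmp r t (n, k') := by
  have hn : Even (n + 1) ↔ ¬Even n := Int.even_add_one
  grind [ringAmp, axialAmp]

variable [NeZero M]

theorem even_ringSource_snd (μ : Site M) :
    Even ((ringSource μ).2 : ℕ) ↔ ¬Even (μ.2 : ℕ) := by
  unfold ringSource
  split_ifs
  exacts [even_val_sub_one _, even_val_add_one _]

theorem ringSource_eq_of_ringSource_succ {n : ℤ} {k k' : Fin (2 * M)}
    (h : ringSource (n + 1, k) = (n + 1, k')) : ringSource (n, k') = (n, k) := by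
  simp only [ringSource, Prod.mk.injEq, true_and, Int.even_add_one] at h ⊢
  grind

/-- The transfer matrix from column `n` to column `n + 1` of solutions of `U(p) ψ = z ψ`. -/
noncomputable def columnTransfer (r t : ℝ) (p : Phases M) (z : ℂ) (n : ℤ) :
    Matrix (Fin (2 * M)) (Fin (2 * M)) ℂ :=
  Matrix.diagonal (fun k : Fin (2 * M) => if Even (k : ℕ) then (p (n + 1, k) : ℂ) else 1) *
    (if Even n then transferEven r t z else transferOdd r t z) *
    Matrix.diagonal (fun k : Fin (2 * M) => if Even (k : ℕ) then 1 else (p (n, k) : ℂ)⁻¹)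

theorem columnTransfer_row_of_even (p : Phases M) (z : ℂ) (n : ℤ) {k k' : Fin (2 * M)}
    (hk : Even (k : ℕ)) (hk' : ringSource (n + 1, k) = (n + 1, k')) :
    columnTransfer r t p z n k =
      Pi.single k (p (n + 1, k) * ((axialAmp r t (n + 1, k) : ℂ) * z)⁻¹) +
        Pi.single k' (p (n + 1, k) * (ringAmp r t (n + 1, k) : ℂ) *
          ((axialAmp r t (n, k') : ℂ) * p (n, k'))⁻¹) := by
  have hadd := even_val_add_one k
  have hsub := even_val_sub_one k
  have hn : Even (n + 1) ↔ ¬Even n := Int.even_add_one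
  funext j
  simp only [ringSource, Prod.mk.injEq, true_and] at hk'
  simp only [columnTransfer, Matrix.mul_diagonal, Matrix.diagonal_mul, Pi.add_apply,
    Pi.single_apply, ringAmp, axialAmp]
  by_cases hnn : Even n <;> simp only [hn, hnn, hk, not_true, not_false_iff, if_true, if_false,
    transferEven, transferOdd, Matrix.of_apply] at hk' ⊢ <;>
    by_cases hj : j = k <;> by_cases hj' : j = k' <;>
    grind [Complex.ofReal_neg, neg_inv, mul_inv]

theorem columnTransfer_row_of_odd (p : Phases M) (z : ℂ) (n : ℤ) {k k' : Fin (2 * M)}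
    (hk : ¬Even (k : ℕ)) (hk' : ringSource (n, k) = (n, k')) :
    columnTransfer r t p z n k =
      Pi.single k (z * ((axialAmp r t (n, k) : ℂ) * p (n, k))⁻¹) -
        Pi.single k' ((ringAmp r t (n, k) : ℂ) * (axialAmp r t (n, k) : ℂ)⁻¹) := by
  have hadd := even_val_add_one k
  have hsub := even_val_sub_one k
  funext j
  simp only [ringSource, Prod.mk.injEq, true_and] at hk'
  simp only [columnTransfer, Matrix.mul_diagonal, Matrix.diagonal_mul, Pi.sub_apply,
    Pi.single_apply, ringAmp, axialAmp]
  by_cases hnn : Even n <;> simp only [hnn, hk, if_true, if_false, transferEven, transferOdd,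
    Matrix.of_apply] at hk' ⊢ <;>
    by_cases hj : j = k <;> by_cases hj' : j = k' <;>
    grind [mul_inv]

/-- The coefficients of column `n + 1` in the equations of `U(p) ψ = z ψ` at the sites which couple
it to column `n`, namely `(n + 1, k)` for even `k` and `(n, k)` for odd `k`. -/
noncomputable def rightLinks (r t : ℝ) (p : Phases M) (z : ℂ) (n : ℤ) :
    Matrix (Fin (2 * M)) (Fin (2 * M)) ℂ :=
  Matrix.of fun k =>
    if Even (k : ℕ) then
      Pi.single k z -
        Pi.single (ringSource (n + 1, k)).2 (p (n + 1, k) * (ringAmp r t (n + 1, k) : ℂ))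
    else -Pi.single k (p (n, k) * (axialAmp r t (n, k) : ℂ))

/-- The coefficients of column `n` in the same equations, moved to the other side: they read
`rightLinks * ψ (n + 1) = leftLinks * ψ n`. -/
noncomputable def leftLinks (r t : ℝ) (p : Phases M) (z : ℂ) (n : ℤ) :
    Matrix (Fin (2 * M)) (Fin (2 * M)) ℂ :=
  Matrix.of fun k =>
    if Even (k : ℕ) then Pi.single k (p (n + 1, k) * (axialAmp r t (n + 1, k) : ℂ))
    else
      Pi.single (ringSource (n, k)).2 (p (n, k) * (ringAmp r t (n, k) : ℂ)) - Pi.single k z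

theorem rightLinks_mul_columnTransfer_row_of_even (h : r ^ 2 + t ^ 2 = 1) (hrt : r * t ≠ 0)
    (p : Phases M) {z : ℂ} (hz : z ≠ 0) (n : ℤ) {k : Fin (2 * M)} (hk : Even (k : ℕ)) :
    (rightLinks r t p z n * columnTransfer r t p z n) k = leftLinks r t p z n k := by
  have ha (μ : Site M) : (axialAmp r t μ : ℂ) ≠ 0 := mod_cast axialAmp_ne_zero hrt μ
  obtain ⟨k', hk'⟩ : ∃ k', ringSource (n + 1, k) = (n + 1, k') := ⟨_, rfl⟩
  have hodd : ¬Even (k' : ℕ) := fun hk'' =>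
    (even_ringSource_snd (n + 1, k)).1 (by rwa [hk']) hk
  have hright : rightLinks r t p z n k =
      Pi.single k z - Pi.single k' (p (n + 1, k) * (ringAmp r t (n + 1, k) : ℂ)) :=
    (if_pos hk).trans (by rw [hk'])
  have hleft : leftLinks r t p z n k =
      Pi.single k (p (n + 1, k) * (axialAmp r t (n + 1, k) : ℂ)) := if_pos hk
  have hamp : (axialAmp r t (n, k') : ℂ) * axialAmp r t (n + 1, k) ^ 2 =
      axialAmp r t (n, k') + axialAmp r t (n + 1, k) * ringAmp r t (n + 1, k) *
        ringAmp r t (n, k') := mod_cast axialAmp_mul_axialAmp_sq h n hk hodd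
  rw [Matrix.mul_apply_eq_vecMul, hright, hleft, Matrix.sub_vecMul, Matrix.single_vecMul,
    Matrix.single_vecMul]
  simp only [Matrix.row, columnTransfer_row_of_even p z n hk hk',
    columnTransfer_row_of_odd p z n hodd (ringSource_eq_of_ringSource_succ hk')]
  have := ha (n, k')
  have := ha (n + 1, k)
  have : (p (n, k') : ℂ) ≠ 0 := Circle.coe_ne_zero _
  simp only [smul_add, smul_sub, ← Pi.single_smul, smul_eq_mul]
  rw [mul_left_comm z (p (n + 1, k) * (ringAmp r t (n + 1, k) : ℂ)), sub_sub_eq_add_sub,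
    add_right_comm, add_sub_cancel_right, ← Pi.single_add]
  congr 1
  field_simp
  linear_combination -hamp

theorem rightLinks_mul_columnTransfer_row_of_odd (hrt : r * t ≠ 0) (p : Phases M)
    (z : ℂ) (n : ℤ) {k : Fin (2 * M)} (hk : ¬Even (k : ℕ)) :
    (rightLinks r t p z n * columnTransfer r t p z n) k = leftLinks r t p z n k := by
  have hright : rightLinks r t p z n k = -Pi.single k (p (n, k) * (axialAmp r t (n, k) : ℂ)) :=
    if_neg hk
  have hleft : leftLinks r t p z n k =
      Pi.single (ringSource (n, k)).2 (p (n, k) * (ringAmp r t (n, k) : ℂ)) - Pi.single k z :=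
    if_neg hk
  have : (axialAmp r t (n, k) : ℂ) ≠ 0 := mod_cast axialAmp_ne_zero hrt (n, k)
  have : (p (n, k) : ℂ) ≠ 0 := Circle.coe_ne_zero _
  rw [Matrix.mul_apply_eq_vecMul, hright, hleft, Matrix.neg_vecMul, Matrix.single_vecMul]
  simp only [Matrix.row]
  rw [columnTransfer_row_of_odd p z n hk rfl, smul_sub, neg_sub, ← Pi.single_smul,
    ← Pi.single_smul, smul_eq_mul, smul_eq_mul]
  congr 2 <;> field_simp

theorem rightLinks_mul_columnTransfer (h : r ^ 2 + t ^ 2 = 1) (hrt : r * t ≠ 0) (p : Phases M)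
    {z : ℂ} (hz : z ≠ 0) (n : ℤ) :
    rightLinks r t p z n * columnTransfer r t p z n = leftLinks r t p z n := by
  funext k
  by_cases hk : Even (k : ℕ)
  · exact rightLinks_mul_columnTransfer_row_of_even h hrt p hz n hk
  · exact rightLinks_mul_columnTransfer_row_of_odd hrt p z n hk

theorem norm_det_rightLinks (p : Phases M) (z : ℂ) (n : ℤ) :
    ‖(rightLinks r t p z n).det‖ = (‖z‖ * |if Even n then t else r|) ^ M := by
  rw [det_eq_prod_diag_of_pred (fun k : Fin (2 * M) => Even (k : ℕ)), norm_prod,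
    ← prod_ite_even_val]
  · refine Finset.prod_congr rfl fun k _ => ?_
    by_cases hk : Even (k : ℕ)
    · have hne : k ≠ (ringSource (n + 1, k)).2 := fun he =>
        (even_ringSource_snd (n + 1, k)).1 (he ▸ hk) hk
      simp [rightLinks, hk, hne]
    · simp only [rightLinks, Matrix.of_apply, hk, if_false, Pi.neg_apply, Pi.single_eq_same,
        norm_neg, norm_mul, Circle.norm_coe, one_mul, Complex.norm_real, Real.norm_eq_abs, axialAmp]
  · intro i j hij hpar
    by_cases hi : Even (i : ℕ)
    · have hne : j ≠ (ringSource (n + 1, i)).2 := fun he =>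
        (even_ringSource_snd (n + 1, i)).1 (he ▸ hpar hi) hi
      simp [rightLinks, hi, hij.symm, hne]
    · simp [rightLinks, hi, hij.symm]

theorem det_leftLinks_ne_zero (hrt : r * t ≠ 0) (p : Phases M) {z : ℂ} (hz : z ≠ 0) (n : ℤ) :
    (leftLinks r t p z n).det ≠ 0 := by
  rw [det_eq_prod_diag_of_pred (fun k : Fin (2 * M) => ¬Even (k : ℕ))]
  · refine Finset.prod_ne_zero_iff.2 fun k _ => ?_
    by_cases hk : Even (k : ℕ)
    · simp [leftLinks, hk, axialAmp_ne_zero hrt]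
    · have hne : k ≠ (ringSource (n, k)).2 := fun he =>
        hk (he ▸ (even_ringSource_snd (n, k)).2 hk)
      simp [leftLinks, hk, hne, hz]
  · intro i j hij hpar
    by_cases hi : Even (i : ℕ)
    · simp [leftLinks, hi, hij.symm]
    · have hne : j ≠ (ringSource (n, i)).2 := fun he =>
        hpar hi (he ▸ (even_ringSource_snd (n, i)).2 hi)
      simp [leftLinks, hi, hij.symm, hne]

theorem det_columnTransfer_ne_zero (h : r ^ 2 + t ^ 2 = 1) (hrt : r * t ≠ 0) (p : Phases M)
    {z : ℂ} (hz : z ≠ 0) (n : ℤ) : (columnTransfer r t p z n).det ≠ 0 := by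
  refine right_ne_zero_of_mul (a := (rightLinks r t p z n).det) ?_
  rw [← Matrix.det_mul, rightLinks_mul_columnTransfer h hrt p hz]
  exact det_leftLinks_ne_zero hrt p hz n

end ColumnTransfer

section Propagator

variable {M : ℕ} [NeZero M] {r t : ℝ}

theorem generator_cellPhases (r t : ℝ) (p : Phases M) (z : ℂ) (j : ℤ) :
    generator r t z (cellPhases p j) =
      columnTransfer r t p z (2 * j + 1) * columnTransfer r t p z (2 * j) := by
  have hmid : Matrix.diagonal (fun k => ((cellPhases p j).2 k : ℂ)) =
      Matrix.diagonal (fun k : Fin (2 * M) =>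
        if Even (k : ℕ) then 1 else (p (2 * j + 1, k) : ℂ)⁻¹) *
      Matrix.diagonal (fun k : Fin (2 * M) =>
        if Even (k : ℕ) then (p (2 * j + 1, k) : ℂ) else 1) := by
    rw [Matrix.diagonal_mul_diagonal]
    congr 1
    funext k
    by_cases hk : Even (k : ℕ) <;> simp [cellPhases, hk]
  have hleft (k : Fin (2 * M)) : (if Even (k : ℕ) then ((cellPhases p j).1 k : ℂ) else 1) =
      if Even (k : ℕ) then (p (2 * j + 1 + 1, k) : ℂ) else 1 :=
    if_ctx_congr Iff.rfl (fun hk => by simp [cellPhases, hk, add_assoc]) fun _ => rfl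
  have hright (k : Fin (2 * M)) : (if Even (k : ℕ) then 1 else ((cellPhases p j).1 k : ℂ)) =
      if Even (k : ℕ) then 1 else (p (2 * j, k) : ℂ)⁻¹ :=
    if_ctx_congr Iff.rfl (fun _ => rfl) fun hk => by simp [cellPhases, hk]
  have hodd : ¬Even (2 * j + 1) := Int.not_even_two_mul_add_one j
  simp only [generator, hmid, hleft, hright, columnTransfer, if_neg hodd,
    if_pos (even_two_mul j), Matrix.mul_assoc]

/-- The transfer matrix over `s` columns starting from column `a`. -/
noncomputable def columnTransferProd (r t : ℝ) (p : Phases M) (z : ℂ) (a : ℤ) :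
    ℕ → Matrix (Fin (2 * M)) (Fin (2 * M)) ℂ
  | 0 => 1
  | s + 1 => columnTransfer r t p z (a + s) * columnTransferProd r t p z a s

theorem columnTransferProd_add (r t : ℝ) (p : Phases M) (z : ℂ) (a : ℤ) (s s' : ℕ) :
    columnTransferProd r t p z a (s + s') =
      columnTransferProd r t p z (a + s) s' * columnTransferProd r t p z a s := by
  induction s' with
  | zero => exact (one_mul _).symm
  | succ s' ih =>
    rw [← add_assoc, columnTransferProd, ih, columnTransferProd, Matrix.mul_assoc, Nat.cast_add,
      add_assoc]

theorem columnTransferProd_two (r t : ℝ) (p : Phases M) (z : ℂ) (j : ℤ) :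
    columnTransferProd r t p z (2 * j) 2 = generator r t z (cellPhases p j) := by
  simp [generator_cellPhases, columnTransferProd]

theorem cocycleForward_cellPhases (r t : ℝ) (p : Phases M) (z : ℂ) (n : ℕ) :
    cocycleForward r t z (cellPhases p) n = columnTransferProd r t p z 0 (2 * n) := by
  induction n with
  | zero => rfl
  | succ n ih =>
    rw [cocycleForward, ih, mul_add_one, columnTransferProd_add, ← columnTransferProd_two, zero_add,
      Nat.cast_mul, Nat.cast_ofNat]

theorem cocycleBackward_cellPhases_inv (h : r ^ 2 + t ^ 2 = 1) (hrt : r * t ≠ 0) (p : Phases M)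
    {z : ℂ} (hz : z ≠ 0) (n : ℕ) :
    (cocycleBackward r t z (cellPhases p) n)⁻¹ =
      columnTransferProd r t p z (-(2 * (n : ℤ))) (2 * n) := by
  induction n with
  | zero => exact inv_one
  | succ n ih =>
    have hunit : IsUnit (generator r t z (cellPhases p (-((n : ℤ) + 1)))).det := by
      rw [isUnit_iff_ne_zero, generator_cellPhases, Matrix.det_mul]
      exact mul_ne_zero (det_columnTransfer_ne_zero h hrt p hz _)
        (det_columnTransfer_ne_zero h hrt p hz _)
    rw [cocycleBackward, Matrix.mul_inv_rev, Matrix.nonsing_inv_nonsing_inv _ hunit, ih,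
      ← columnTransferProd_two, mul_add_one, add_comm (2 * n) 2, columnTransferProd_add]
    push_cast
    congr 2
    ring

theorem propagator_eq_columnTransferProd (h : r ^ 2 + t ^ 2 = 1) (hrt : r * t ≠ 0) (p : Phases M)
    {z : ℂ} (hz : z ≠ 0) (L : ℕ) :
    propagator r t p z L = columnTransferProd r t p z (-(2 * (L : ℤ))) (2 * (2 * L)) := by
  rw [propagator, cocycleForward_cellPhases, cocycleBackward_cellPhases_inv h hrt p hz,
    two_mul (2 * L), columnTransferProd_add, Nat.cast_mul, Nat.cast_ofNat, neg_add_cancel]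

end Propagator

section CharacteristicDeterminant

/-- The numbering of the columns `-2L, …, 2L` of the finite cylinder from left to right. -/
def columnNumbering (L : ℕ) :
    Fin (2 * (2 * L) + 1) ≃ Finset.Icc (-(2 * (L : ℤ))) (2 * (L : ℤ)) where
  toFun i := ⟨-(2 * (L : ℤ)) + i, Finset.mem_Icc.2 (by omega)⟩
  invFun n := ⟨(n + 2 * (L : ℤ)).toNat, by have := Finset.mem_Icc.1 n.2; omega⟩
  left_inv i := Fin.ext (by simp)
  right_inv n := Subtype.ext (by have := Finset.mem_Icc.1 n.2; push_cast; omega)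

variable {M : ℕ}

/-- The sites of the finite cylinder, numbered column by column. -/
def siteEquiv (L M : ℕ) : Fin (2 * (2 * L) + 1) × Fin (2 * M) ≃ Box L M :=
  (columnNumbering L).prodCongr (Equiv.refl _)

/-- The sites of the finite cylinder, numbered so that the equations of `U^D ψ = z ψ` at the `i`-th
group of sites couple the columns `i - 1` and `i` only: the odd sites are moved by one column,
cyclically, which makes the walls the `0`-th group. -/
def equationEquiv (L M : ℕ) : Fin (2 * (2 * L) + 1) × Fin (2 * M) ≃ Box L M :=
  ((Equiv.prodComm _ _).trans ((Equiv.refl _).prodShear fun k : Fin (2 * M) =>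
    (if Even (k : ℕ) then Equiv.refl _ else Equiv.subRight 1))).trans
      ((Equiv.prodComm _ _).trans (siteEquiv L M))

theorem toSite_siteEquiv (L : ℕ) (i : Fin (2 * (2 * L) + 1)) (k : Fin (2 * M)) :
    (siteEquiv L M (i, k)).toSite = (-(2 * (L : ℤ)) + i, k) :=
  rfl

theorem equationEquiv_zero (L : ℕ) (k : Fin (2 * M)) :
    equationEquiv L M (0, k) = siteEquiv L M (if Even (k : ℕ) then 0 else Fin.last _, k) := by
  have hlast : (0 : Fin (2 * (2 * L) + 1)) - 1 = Fin.last _ :=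
    sub_eq_iff_eq_add.2 (Fin.last_add_one _).symm
  by_cases hk : Even (k : ℕ) <;> simp [equationEquiv, hk, -zero_sub, hlast]

theorem equationEquiv_succ {L : ℕ} (i : Fin (2 * (2 * L))) (k : Fin (2 * M)) :
    equationEquiv L M (i.succ, k) =
      siteEquiv L M (if Even (k : ℕ) then i.succ else i.castSucc, k) := by
  have hpred : i.succ - 1 = i.castSucc := sub_eq_iff_eq_add.2 Fin.coeSucc_eq_succ.symm
  by_cases hk : Even (k : ℕ) <;> simp [equationEquiv, hk, hpred]

theorem isWall_equationEquiv_zero (L : ℕ) (k : Fin (2 * M)) :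
    IsWall L (equationEquiv L M (0, k)).toSite := by
  rw [isWall_toSite_iff, equationEquiv_zero, toSite_siteEquiv]
  by_cases hk : Even (k : ℕ)
  · exact Or.inl ⟨by simp [hk], hk⟩
  · refine Or.inr ⟨?_, Nat.not_even_iff_odd.1 hk⟩
    rw [if_neg hk, Fin.val_last]
    push_cast
    ring

variable [NeZero M]

/-- The rows of `z - U^D` at those sites `k` of a wall column which lie on the wall, `q k`, where
the outgoing link `k` is fed by the reflected link `k - 1`. -/
def wallRows (q : Fin (2 * M) → Prop) [DecidablePred q] (z : ℂ) :
    Matrix (Fin (2 * M)) (Fin (2 * M)) ℂ :=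
  Matrix.of fun k => if q k then Pi.single k z - Pi.single (k - 1) 1 else 0

theorem wallRows_of_mem {q : Fin (2 * M) → Prop} [DecidablePred q] (z : ℂ) {k : Fin (2 * M)}
    (hk : q k) : wallRows q z k = Pi.single k z - Pi.single (k - 1) 1 :=
  if_pos hk

theorem wallRows_of_not_mem {q : Fin (2 * M) → Prop} [DecidablePred q] (z : ℂ) {k : Fin (2 * M)}
    (hk : ¬q k) : wallRows q z k = 0 :=
  if_neg hk

variable {r t : ℝ}

theorem scalar_sub_reflected_apply (r t : ℝ) (p : Phases M) (L : ℕ) (z : ℂ) (μ ν : Box L M) :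
    (Matrix.scalar (Box L M) z - reflected r t p L) μ ν =
      (if ν.toSite = μ.toSite then z else 0) -
        (if ν.toSite = ringSource μ.toSite then ringEntry r t p L μ.toSite else 0) -
        if ν.toSite = axialSource μ.toSite then axialEntry r t p L μ.toSite else 0 := by
  simp only [Matrix.sub_apply, Matrix.scalar_apply, Matrix.diagonal_apply, reflected_apply,
    sub_add_eq_sub_sub, toSite_injective.eq_iff, eq_comm]

theorem scalar_sub_reflected_apply_of_isWall (r t : ℝ) (p : Phases M) {L : ℕ} (z : ℂ)
    {μ : Box L M} (hμ : IsWall L μ.toSite) (ν : Box L M) :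
    (Matrix.scalar (Box L M) z - reflected r t p L) μ ν =
      (if ν = μ then z else 0) - if ν = (μ.1, μ.2 - 1) then 1 else 0 := by
  rw [scalar_sub_reflected_apply, if_neg (hμ.toSite_ne_axialSource ν), sub_zero,
    ringSource_toSite_of_isWall hμ, ringEntry, if_pos hμ]
  simp only [toSite_injective.eq_iff]

theorem scalar_sub_reflected_apply_of_not_isWall (r t : ℝ) (p : Phases M) {L : ℕ} (z : ℂ)
    {μ : Box L M} (hμ : ¬IsWall L μ.toSite) (ν : Box L M) :
    (Matrix.scalar (Box L M) z - reflected r t p L) μ ν =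
      (if ν.toSite = μ.toSite then z else 0) -
        (if ν.toSite = ringSource μ.toSite then p μ.toSite * (ringAmp r t μ.toSite : ℂ) else 0) -
        if ν.toSite = axialSource μ.toSite then p μ.toSite * (axialAmp r t μ.toSite : ℂ)
        else 0 := by
  rw [scalar_sub_reflected_apply, ringEntry, axialEntry, if_neg hμ, if_neg hμ]

theorem scalar_sub_reflected_equationEquiv_zero (r t : ℝ) (p : Phases M) (L : ℕ) (z : ℂ)
    (k : Fin (2 * M)) (j : Fin (2 * (2 * L) + 1)) (l : Fin (2 * M)) :
    (Matrix.scalar (Box L M) z - reflected r t p L) (equationEquiv L M (0, k))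
        (siteEquiv L M (j, l)) =
      (if j = 0 then wallRows (fun k : Fin (2 * M) => Even (k : ℕ)) z k l else 0) +
        if j = Fin.last _ then wallRows (fun k : Fin (2 * M) => ¬Even (k : ℕ)) z k l else 0 := by
  have hwall (i : Fin (2 * (2 * L) + 1)) :
      (((siteEquiv L M (i, k)).1, (siteEquiv L M (i, k)).2 - 1) : Box L M) =
        siteEquiv L M (i, k - 1) := rfl
  rw [scalar_sub_reflected_apply_of_isWall r t p z (isWall_equationEquiv_zero L k),
    equationEquiv_zero, hwall]
  by_cases hk : Even (k : ℕ)
  · by_cases hj : j = 0 <;> simp [-Nat.not_even_iff_odd, hj, hk, wallRows, Pi.single_apply]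
  · by_cases hj : j = Fin.last _ <;>
      simp [-Nat.not_even_iff_odd, hj, hk, wallRows, Pi.single_apply]

theorem scalar_sub_reflected_equationEquiv_succ (r t : ℝ) (p : Phases M) (L : ℕ) (z : ℂ)
    (i : Fin (2 * (2 * L))) (k : Fin (2 * M)) (j : Fin (2 * (2 * L) + 1)) (l : Fin (2 * M)) :
    (Matrix.scalar (Box L M) z - reflected r t p L) (equationEquiv L M (i.succ, k))
        (siteEquiv L M (j, l)) =
      (if j = i.succ then rightLinks r t p z (-(2 * (L : ℤ)) + (i : ℕ)) k l else 0) -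
        if j = i.castSucc then leftLinks r t p z (-(2 * (L : ℤ)) + (i : ℕ)) k l else 0 := by
  have hi := i.2
  have hsucc : (-(2 * (L : ℤ)) + (j : ℕ) = -(2 * (L : ℤ)) + (i : ℕ) + 1) ↔ j = i.succ := by
    rw [Fin.ext_iff, Fin.val_succ]
    omega
  have hcast : (-(2 * (L : ℤ)) + (j : ℕ) = -(2 * (L : ℤ)) + (i : ℕ)) ↔ j = i.castSucc := by
    rw [Fin.ext_iff, Fin.val_castSucc]
    omega
  by_cases hk : Even (k : ℕ)
  · have hrow : (equationEquiv L M (i.succ, k)).toSite = (-(2 * (L : ℤ)) + (i : ℕ) + 1, k) := by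
      rw [equationEquiv_succ, if_pos hk, toSite_siteEquiv, Fin.val_succ, Nat.cast_succ, add_assoc]
    have hwall : ¬IsWall L (equationEquiv L M (i.succ, k)).toSite := by
      rw [hrow, IsWall, axialSource, Finset.mem_Icc, if_pos hk]
      omega
    rw [scalar_sub_reflected_apply_of_not_isWall r t p z hwall, hrow, toSite_siteEquiv]
    simp only [Prod.mk.injEq, hsucc, hcast, ringSource, axialSource, hk, if_true,
      add_sub_cancel_right, rightLinks, leftLinks, Matrix.of_apply, Pi.sub_apply, Pi.single_apply]
    grind
  · have hrow : (equationEquiv L M (i.succ, k)).toSite = (-(2 * (L : ℤ)) + (i : ℕ), k) := by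
      rw [equationEquiv_succ, if_neg hk, toSite_siteEquiv, Fin.val_castSucc]
    have hwall : ¬IsWall L (equationEquiv L M (i.succ, k)).toSite := by
      rw [hrow, IsWall, axialSource, Finset.mem_Icc, if_neg hk]
      omega
    rw [scalar_sub_reflected_apply_of_not_isWall r t p z hwall, hrow, toSite_siteEquiv]
    simp only [Prod.mk.injEq, hsucc, hcast, ringSource, axialSource, hk, if_false, rightLinks,
      leftLinks, Matrix.of_apply, Pi.sub_apply, Pi.neg_apply, Pi.single_apply]
    grind

theorem scalar_sub_reflected_submatrix (r t : ℝ) (p : Phases M) (L : ℕ) (z : ℂ) :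
    (Matrix.scalar (Box L M) z - reflected r t p L).submatrix (equationEquiv L M) (siteEquiv L M) =
      Matrix.comp _ _ _ _ ℂ (cyclicBidiagonal
        (wallRows (fun k : Fin (2 * M) => Even (k : ℕ)) z)
        (wallRows (fun k : Fin (2 * M) => ¬Even (k : ℕ)) z)
        (fun i => leftLinks r t p z (-(2 * (L : ℤ)) + (i : ℕ)))
        fun i => rightLinks r t p z (-(2 * (L : ℤ)) + (i : ℕ))) := by
  ext ⟨i, k⟩ ⟨j, l⟩
  cases i using Fin.cases with
  | zero =>
    rw [Matrix.submatrix_apply, scalar_sub_reflected_equationEquiv_zero]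
    simp only [cyclicBidiagonal, Matrix.comp_apply, Matrix.of_apply, Fin.cons_zero, Pi.add_apply,
      Pi.single_apply, Matrix.add_apply]
    split_ifs <;> rfl
  | succ i =>
    rw [Matrix.submatrix_apply, scalar_sub_reflected_equationEquiv_succ]
    simp only [cyclicBidiagonal, Matrix.comp_apply, Matrix.of_apply, Fin.cons_succ, Pi.sub_apply,
      Pi.single_apply, Matrix.sub_apply]
    split_ifs <;> rfl

theorem norm_det_scalar_sub_reflected (h : r ^ 2 + t ^ 2 = 1) (hrt : r * t ≠ 0)
    (p : Phases M) (L : ℕ) {z : ℂ} (hz : z ≠ 0) :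
    ‖(Matrix.scalar (Box L M) z - reflected r t p L).det‖ =
      ‖(wallRows (fun k : Fin (2 * M) => Even (k : ℕ)) z +
        wallRows (fun k : Fin (2 * M) => ¬Even (k : ℕ)) z * propagator r t p z L).det‖ *
      (‖z‖ ^ 2 * |r * t|) ^ (2 * L * M) := by
  rw [← norm_det_submatrix_equiv_equiv (equationEquiv L M) (siteEquiv L M),
    scalar_sub_reflected_submatrix, propagator_eq_columnTransferProd h hrt p hz,
    det_cyclicBidiagonal (P := fun i => columnTransferProd r t p z (-(2 * (L : ℤ))) i) _ _ rfl,
    norm_mul, norm_prod, Fin.val_last]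
  · have hparity (i : ℕ) : Even (-(2 * (L : ℤ)) + i) ↔ Even i := by simp [parity_simps]
    simp only [norm_det_rightLinks, hparity, apply_ite abs, mul_ite, Finset.prod_pow]
    rw [prod_ite_even_val, ← pow_mul, abs_mul]
    ring
  · intro i
    rw [Fin.val_succ, columnTransferProd, ← Matrix.mul_assoc,
      rightLinks_mul_columnTransfer h hrt p hz, Fin.val_castSucc]

theorem norm_det_wallRows_add_le (z : ℂ) (P : Matrix (Fin (2 * M)) (Fin (2 * M)) ℂ) :
    ‖(wallRows (fun k : Fin (2 * M) => Even (k : ℕ)) z +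
      wallRows (fun k : Fin (2 * M) => ¬Even (k : ℕ)) z * P).det‖ ≤
      (1 + ‖z‖) ^ (2 * M) * exteriorPowerNorm M P := by
  let Q (k : Fin (2 * M)) (b : Bool) : Fin (2 * M) → ℂ :=
    if Even (k : ℕ) then (1 : Matrix _ _ ℂ) (bif b then k else k - 1)
    else P (bif b then k else k - 1)
  have hrows : wallRows (fun k : Fin (2 * M) => Even (k : ℕ)) z +
      wallRows (fun k : Fin (2 * M) => ¬Even (k : ℕ)) z * P =
      Matrix.of fun k => ∑ b : Bool, (bif b then z else -1) • Q k b := by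
    ext k l
    rw [Matrix.add_apply, Matrix.mul_apply_eq_vecMul, Matrix.of_apply, Fintype.sum_bool]
    by_cases hk : Even (k : ℕ)
    · simp only [wallRows_of_mem (q := fun k : Fin (2 * M) => Even (k : ℕ)) z hk,
        wallRows_of_not_mem (q := fun k : Fin (2 * M) => ¬Even (k : ℕ)) z (not_not.mpr hk), Q, hk,
        if_true, cond_true, cond_false, Matrix.zero_vecMul]
      simp [Matrix.one_apply, Pi.single_apply, eq_comm, sub_eq_add_neg]
    · simp only [wallRows_of_not_mem (q := fun k : Fin (2 * M) => Even (k : ℕ)) z hk,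
        wallRows_of_mem (q := fun k : Fin (2 * M) => ¬Even (k : ℕ)) z hk, Q, hk, if_false,
        cond_true, cond_false, Matrix.sub_vecMul, Matrix.single_vecMul]
      simp [Matrix.row, sub_eq_add_neg]
  rw [hrows]
  refine (norm_det_sum_smul_rows_le (K := exteriorPowerNorm M P) _ Q fun f => ?_).trans_eq ?_
  · refine (norm_det_rows_one_or_le_exteriorPowerNorm P (fun k => Even (k : ℕ))
      fun k => bif f k then k else k - 1).trans_eq ?_
    rw [card_subtype_not_even_val]
  · simp [add_comm]

theorem norm_det_scalar_sub_reflected_le (h : r ^ 2 + t ^ 2 = 1) (hrt : r * t ≠ 0)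
    (p : Phases M) (L : ℕ) {z : ℂ} (hz : z ≠ 0) :
    ‖(Matrix.scalar (Box L M) z - reflected r t p L).det‖ ≤
      (1 + ‖z‖) ^ (2 * M) * exteriorPowerNorm M (propagator r t p z L) *
        (‖z‖ ^ 2 * |r * t|) ^ (2 * L * M) := by
  rw [norm_det_scalar_sub_reflected h hrt p L hz]
  gcongr
  exact norm_det_wallRows_add_le z _

end CharacteristicDeterminant

section LogarithmicBound

open MeasureTheory

theorem log_one_add_le_one_add_abs_log {x : ℝ} (hx : 0 < x) :
    Real.log (1 + x) ≤ 1 + |Real.log x| := by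
  have h_exp : max 1 x ≤ Real.exp |Real.log x| :=
    max_le (Real.one_le_exp (abs_nonneg _))
      ((Real.log_le_iff_le_exp hx).mp (le_abs_self _))
  rw [Real.log_le_iff_le_exp (by positivity), Real.exp_add]
  calc 1 + x ≤ 2 * max 1 x := by linarith [le_max_left 1 x, le_max_right 1 x]
    _ ≤ Real.exp 1 * Real.exp |Real.log x| := by
      gcongr
      linarith [Real.add_one_le_exp 1]

theorem det_scalar_sub_ne_zero_iff {n K : Type*} [Fintype n] [DecidableEq n] [Field K]
    {A : Matrix n n K} {z : K} : (Matrix.scalar n z - A).det ≠ 0 ↔ z ∉ spectrum K A := by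
  rw [spectrum.notMem_iff, Matrix.isUnit_iff_isUnit_det, isUnit_iff_ne_zero]
  rfl

theorem det_scalar_sub_eq_prod_roots {n K : Type*} [Fintype n] [DecidableEq n] [Field K]
    [IsAlgClosed K] (A : Matrix n n K) (z : K) :
    (Matrix.scalar n z - A).det = (A.charpoly.roots.map fun x => z - x).prod := by
  rw [← Matrix.eval_charpoly,
    (IsAlgClosed.splits _).eval_eq_prod_roots_of_monic (Matrix.charpoly_monic _)]

theorem log_norm_det_scalar_sub {n : Type*} [Fintype n] [DecidableEq n] {A : Matrix n n ℂ} {z : ℂ}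
    (hz : z ∉ spectrum ℂ A) :
    Real.log ‖(Matrix.scalar n z - A).det‖ =
      (A.charpoly.roots.map fun x => Real.log ‖z - x‖).sum := by
  have hprod : ‖(Matrix.scalar n z - A).det‖ = (A.charpoly.roots.map fun x => ‖z - x‖).prod := by
    rw [det_scalar_sub_eq_prod_roots]
    exact (map_multiset_prod (normHom : ℂ →*₀ ℝ) _).trans (by rw [Multiset.map_map]; rfl)
  have hdet := norm_ne_zero_iff.mpr (det_scalar_sub_ne_zero_iff.mpr hz)
  rw [hprod] at hdet ⊢
  rw [Real.log_multiset_prod fun x hx h0 => hdet (Multiset.prod_eq_zero (h0 ▸ hx)),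
    Multiset.map_map]
  rfl

variable {M : ℕ} [NeZero M] {r t : ℝ}

theorem integral_log_densityOfStates (h : r ^ 2 + t ^ 2 = 1) (p : Phases M) (L : ℕ) {z : ℂ}
    (hz : z ∉ spectrum ℂ (reflected r t p L)) :
    ∫ x : Circle, Real.log ‖z - (x : ℂ)‖ ∂(densityOfStates r t p L) =
      ((4 * (L : ℝ) + 1) * (2 * M))⁻¹ *
        Real.log ‖(Matrix.scalar (Box L M) z - reflected r t p L).det‖ := by
  rw [integral_densityOfStates h p L fun x => Real.log ‖z - x‖, log_norm_det_scalar_sub hz,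
    smul_eq_mul]

theorem log_norm_det_scalar_sub_reflected_le (h : r ^ 2 + t ^ 2 = 1) (hrt : r * t ≠ 0)
    (p : Phases M) (L : ℕ) {z : ℂ} (hz : z ≠ 0)
    (hz' : z ∉ spectrum ℂ (reflected r t p L)) :
    Real.log ‖(Matrix.scalar (Box L M) z - reflected r t p L).det‖ ≤
      2 * M * (1 + |Real.log ‖z‖|) + Real.log (exteriorPowerNorm M (propagator r t p z L)) +
        2 * L * M * (2 * Real.log ‖z‖ + Real.log |r * t|) := by
  have hz₀ : 0 < ‖z‖ := norm_pos_iff.mpr hz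
  have hrt₀ : 0 < |r * t| := abs_pos.mpr hrt
  have hdet_pos := norm_pos_iff.mpr (det_scalar_sub_ne_zero_iff.mpr hz')
  have hdet_le := norm_det_scalar_sub_reflected_le h hrt p L hz
  have hnorm_ne : exteriorPowerNorm M (propagator r t p z L) ≠ 0 := fun h₀ => by
    rw [h₀, mul_zero, zero_mul] at hdet_le
    exact hdet_le.not_gt hdet_pos
  refine (Real.log_le_log hdet_pos hdet_le).trans ?_
  rw [Real.log_mul (by positivity) (by positivity), Real.log_mul (by positivity) hnorm_ne,
    Real.log_pow, Real.log_pow, Real.log_mul (by positivity) hrt₀.ne', Real.log_pow]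
  push_cast
  gcongr
  exact log_one_add_le_one_add_abs_log hz₀

theorem le_log_exteriorPowerNorm_propagator (h : r ^ 2 + t ^ 2 = 1) (hrt : r * t ≠ 0)
    (p : Phases M) {L : ℕ} (hL : 1 ≤ L) {z : ℂ} (hz : z ≠ 0)
    (hz' : z ∉ spectrum ℂ (reflected r t p L)) :
    (1 / 2) * Real.log (1 / |r * t|)
        + (2 + 1 / (2 * (L : ℝ))) *
          (∫ x : Circle, Real.log ‖z - (x : ℂ)‖ ∂(densityOfStates r t p L))
        - (1 + 1 / (4 * (L : ℝ))) * Real.log ‖z‖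
        - (1 + |Real.log ‖z‖|) / (L : ℝ)
      ≤ 1 / (4 * (L : ℝ) * (M : ℝ)) *
        Real.log (exteriorPowerNorm M (propagator r t p z L)) := by
  have hL₀ : (L : ℝ) ≠ 0 := Nat.cast_ne_zero.mpr (Nat.one_le_iff_ne_zero.mp hL)
  have hM₀ : (M : ℝ) ≠ 0 := NeZero.ne _
  have hslack : 0 ≤ (2 + 2 * |Real.log ‖z‖| + Real.log ‖z‖) / (4 * (L : ℝ)) :=
    div_nonneg (by linarith [abs_nonneg (Real.log ‖z‖), neg_abs_le (Real.log ‖z‖)]) (by positivity)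
  have hdet_le : 1 / (4 * (L : ℝ) * M) *
      (Real.log ‖(Matrix.scalar (Box L M) z - reflected r t p L).det‖ -
        2 * M * (1 + |Real.log ‖z‖|) - 2 * L * M * (2 * Real.log ‖z‖ + Real.log |r * t|)) ≤
      1 / (4 * (L : ℝ) * M) * Real.log (exteriorPowerNorm M (propagator r t p z L)) := by
    gcongr
    linarith [log_norm_det_scalar_sub_reflected_le h hrt p L hz hz']
  refine (le_add_of_nonneg_right hslack).trans (hdet_le.trans_eq' ?_)
  rw [integral_log_densityOfStates h p L hz', one_div |r * t|, Real.log_inv]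
  field_simp [hL₀, hM₀]
  ring

end LogarithmicBound

end ChalkerCoddington

open ChalkerCoddington in
theorem mainTheorem6_general {M : ℕ} [NeZero M] {r t : ℝ} (h : r ^ 2 + t ^ 2 = 1) :
    (∀ (p : Phases M) (L : ℕ), MeasureTheory.IsProbabilityMeasure (densityOfStates r t p L) ∧
      ∀ f : ℂ → ℂ, (1 / ((4 * (L : ℂ) + 1) * (2 * (M : ℂ)))) * (cfc f (reflected r t p L)).trace =
        ∫ x : Circle, f (x : ℂ) ∂(densityOfStates r t p L)) ∧
    (∀ᵐ p ∂(phaseLaw M), ∀ f : C(Circle, ℂ),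
      Filter.Tendsto (fun L : ℕ => ∫ x, f x ∂(densityOfStates r t p L))
        Filter.atTop (nhds (∫ x, f x ∂dl))) ∧
    (r * t ≠ 0 → ∀ (p : Phases M) (L : ℕ), 1 ≤ L → ∀ z : ℂ, z ≠ 0 →
      z ∉ spectrum ℂ (reflected r t p L) →
        (1 / 2) * Real.log (1 / |r * t|)
            + (2 + 1 / (2 * (L : ℝ))) *
              (∫ x : Circle, Real.log ‖z - (x : ℂ)‖ ∂(densityOfStates r t p L))
            - (1 + 1 / (4 * (L : ℝ))) * Real.log ‖z‖
            - (1 + |Real.log ‖z‖|) / (L : ℝ)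
          ≤ 1 / (4 * (L : ℝ) * (M : ℝ)) *
            Real.log (exteriorPowerNorm M (propagator r t p z L))) :=
  ⟨fun p L => ⟨isProbabilityMeasure_densityOfStates h p L, trace_cfc_reflected h p L⟩,
    ae_tendsto_integral_densityOfStates h,
    fun hrt p _ hL _ hz hspec => le_log_exteriorPowerNorm_propagator h hrt p hL hz hspec⟩

theorem mainTheorem6 (M : ℕ) [NeZero M] :
    (∀ r t : ℝ, r ∈ Set.Icc (0 : ℝ) 1 → t ∈ Set.Icc (0 : ℝ) 1 → r ^ 2 + t ^ 2 = 1 → r * t ≠ 0 →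
      (∀ (p : ChalkerCoddington.Phases M) (L : ℕ),
        MeasureTheory.IsProbabilityMeasure (ChalkerCoddington.densityOfStates r t p L) ∧
        ∀ f : ℂ → ℂ, ContinuousOn f (Metric.sphere (0 : ℂ) 1) →
          (1 / ((4 * (L : ℂ) + 1) * (2 * (M : ℂ)))) *
              (cfc f (ChalkerCoddington.reflected r t p L)).trace =
            ∫ x : Circle, f (x : ℂ) ∂(ChalkerCoddington.densityOfStates r t p L)) ∧
      (∀ᵐ p ∂(ChalkerCoddington.phaseLaw M), ∀ f : C(Circle, ℂ),
        Filter.Tendsto (fun L : ℕ => ∫ x, f x ∂(ChalkerCoddington.densityOfStates r t p L))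
          Filter.atTop (nhds (∫ x, f x ∂ChalkerCoddington.dl)))) ∧
    (∃ c : ℝ, 0 < c ∧
      ∀ r t : ℝ, r ∈ Set.Icc (0 : ℝ) 1 → t ∈ Set.Icc (0 : ℝ) 1 → r ^ 2 + t ^ 2 = 1 → r * t ≠ 0 →
      ∀ (p : ChalkerCoddington.Phases M) (L : ℕ), 1 ≤ L → ∀ z : ℂ, z ≠ 0 → ‖z‖ ≠ 1 →
        (1 / 2) * Real.log (1 / (r * t))
            + (2 + 1 / (2 * (L : ℝ))) *
              (∫ x : Circle, Real.log ‖z - (x : ℂ)‖ ∂(ChalkerCoddington.densityOfStates r t p L))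
            - (1 + 1 / (4 * (L : ℝ))) * Real.log ‖z‖
            - c * (1 + |Real.log ‖z‖|) / (L : ℝ)
          ≤ 1 / (4 * (L : ℝ) * (M : ℝ)) *
            Real.log (ChalkerCoddington.exteriorPowerNorm M
              (ChalkerCoddington.propagator r t p z L))) := by
  refine ⟨fun r t _ _ h _ => ?_, 1, one_pos, fun r t hr ht h hrt p L hL z hz hz' => ?_⟩
  · obtain ⟨hprob, hflat, -⟩ := mainTheorem6_general (M := M) h
    exact ⟨fun p L => ⟨(hprob p L).1, fun f _ => (hprob p L).2 f⟩, hflat⟩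
  · have hbound := (mainTheorem6_general h).2.2 hrt p L hL z hz fun hspec =>
      hz' (ChalkerCoddington.norm_eq_one_of_mem_spectrum_reflected h hspec)
    rwa [abs_of_nonneg (mul_nonneg hr.1 ht.1), ← one_mul (1 + |Real.log ‖z‖|)] at hbound
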